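/- **Theorem (sinc quadrature error).** Let $d\ge 1$, let $D\subset\mathbb R^d$ be an open set (for instance a bounded polygonal Lipschitz domain), and let $s\in(0,1)$. For $\eta\in L^2(D)$ real-valued, let $\tilde\eta$ be its extension by zero to $\mathbb R^d$, let $\mathcal F$ be the unitary Fourier transform on $L^2(\mathbb R^d)$ (kernel $(2\pi)^{-d/2}e^{-i x\cdot\zeta}$), and let $(-\Delta)^{\alpha}$ be the operator with $\mathcal F((-\Delta)^\alpha f)(\zeta)=|\zeta|^{2\alpha}\mathcal F(f)(\zeta)$ on the domain $\{f\in L^2(\mathbb R^d): |\zeta|^{2\alpha}\mathcal F(f)\in L^2(\mathbb R^d)\}$. For $0<r<2$ let $\widetilde H^r(D)$ be the space of $\eta\in L^2(D)$ with $\|\tilde\eta\|_{H^r(\mathbb R^d)}^2:=\int_{\mathbb R^d}(1+|\zeta|^2)^r|\mathcal F(\tilde\eta)(\zeta)|^2\,d\zeta<\infty$, normed by $$\|\eta\|_{\widetilde H^r(D)}:=\Big(\tfrac{c_{d,r}}2\int_{\mathbb R^d}\int_{\mathbb R^d}\frac{(\tilde\eta(x)-\tilde\eta(y))^2}{|x-y|^{d+2r}}\,dy\,dx\Big)^{1/2}\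 (0<r<1),\qquad \|\eta\|_{\widetilde H^r(D)}:=\|\tilde\eta\|_{H^r(\mathbb R^d)}\ (1\le r<2),$$ where $c_{d,r}:=\big(\int_{\mathbb R^d}\frac{1-\cos h_1}{|h|^{d+2r}}\,dh\big)^{-1}$ is the normalization constant in $(-\Delta)^r\phi(x)=c_{d,r}\,\mathrm{PV}\!\int\frac{\phi(x)-\phi(y)}{|x-y|^{d+2r}}\,dy$. For $\eta,\theta\in\widetilde H^s(D)$ let $$a(\eta,\theta):=\int_{\mathbb R^d}[(-\Delta)^{s/2}\tilde\eta]\,[(-\Delta)^{s/2}\tilde\theta]\,dx .$$ For $t>0$ and $\psi\in L^2(\mathbb R^d)$ put $w(\psi,t):=-t^2\Delta(I-t^2\Delta)^{-1}\psi$. For $k>0$ and integers $N^-,N^+\ge 0$ put $y_j:=jk$, $t_j:=e^{-y_j/2}$, and $$a^k(\eta,\theta):=\frac{c_sk}{2}\sum_{j=-N^-}^{N^+}e^{sy_j}\int_D w(\tilde\eta,t_j)\,\theta\,dx,\qquad c_s:=\Big(\int_0^\infty\frac{y^{1-2s}}{1+y^2}\,dy\Big)^{-1}.$$ Then for every $\mathsf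 d\in(0,\pi)$, every $\delta\in(s,2-s]$, every $\theta\in\widetilde H^s(D)$ and every $\eta\in\widetilde H^\delta(D)$, $$\begin{aligned}|a(\eta,\theta)-a^k(\eta,\theta)|\le{}&\frac{2c(\mathsf d)}{\delta-s}\Big(\frac{2}{e^{2\pi\mathsf d/k}-1}+e^{(s-\delta)N^+k/2}\Big)\|\eta\|_{\widetilde H^\delta(D)}\|\theta\|_{\widetilde H^s(D)}\\&+\frac{c(\mathsf d)}{s}\Big(\frac{2}{e^{2\pi\mathsf d/k}-1}+e^{-sN^-k}\Big)\|\eta\|_{L^2(D)}\|\theta\|_{L^2(D)},\end{aligned}$$ where $c(\mathsf d):=\dfrac1{\sqrt{(1+\cos\mathsf d)/2}}$. -/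

import Mathlib

open MeasureTheory Set
open scoped FourierTransform ENNReal

noncomputable section

namespace SincQuad

/-- Euclidean space `ℝ^d`. -/
abbrev E (d : ℕ) : Type := EuclideanSpace ℝ (Fin d)

/-- `L²(ℝ^d)`, with complex values. -/
abbrev L2 (d : ℕ) : Type := Lp (α := E d) ℂ 2

/-- `L²(D)`, the real-valued square integrable functions on the open set `D`. -/
abbrev L2D {d : ℕ} (D : TopologicalSpace.Opens (E d)) : Type :=
  Lp ℝ 2 ((volume : Measure (E d)).restrict (D : Set (E d)))

/-- Extension by zero of a function on `D`, as a real-valued function on `ℝ^d`. -/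
def zeroExtFun {d : ℕ} (D : TopologicalSpace.Opens (E d)) (η : L2D D) : E d → ℝ :=
  (D : Set (E d)).indicator η

theorem memLp_zeroExtFun {d : ℕ} (D : TopologicalSpace.Opens (E d)) (η : L2D D) :
    MemLp (fun x => (zeroExtFun D η x : ℂ)) 2 (volume : Measure (E d)) :=
  ((memLp_indicator_iff_restrict D.isOpen.measurableSet).2 (Lp.memLp η)).ofReal

/-- Extension by zero, as an element of `L²(ℝ^d)`. -/
def zeroExt {d : ℕ} (D : TopologicalSpace.Opens (E d)) (η : L2D D) : L2 d :=
  (memLp_zeroExtFun D η).toLp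

/-- The symbol `|ζ|^{2α}` of `(-Δ)^α`. The Fourier transform of Mathlib has the kernel
`exp (-2πi ⟨x, ξ⟩)`, so that the angular frequency is `ζ = 2πξ`; with this substitution it is
the unitary Fourier transform for which `(-Δ)^α` is multiplication by `|ζ|^{2α}`. -/
def lapSymbol {d : ℕ} (α : ℝ) (ξ : E d) : ℝ := (2 * Real.pi * ‖ξ‖) ^ (2 * α)

/-- The domain `{f ∈ L²(ℝ^d) : |ζ|^{2α} 𝓕 f ∈ L²(ℝ^d)}` of the unbounded operator `(-Δ)^α`. -/
def fracLapDomain {d : ℕ} (α : ℝ) : Set (L2 d) :=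
  {f | MemLp (fun ξ : E d => (lapSymbol α ξ : ℂ) * (𝓕 f : L2 d) ξ) 2 volume}

open Classical in
/-- The fractional Laplacian `(-Δ)^α` on its domain (with value `0` outside of it):
`𝓕 ((-Δ)^α f) = |ζ|^{2α} 𝓕 f`. For `α = 1` this is the operator `-Δ` on `H²(ℝ^d)`. -/
def fracLap {d : ℕ} (α : ℝ) (f : L2 d) : L2 d :=
  if h : MemLp (fun ξ : E d => (lapSymbol α ξ : ℂ) * (𝓕 f : L2 d) ξ) 2 volume then
    𝓕⁻ (h.toLp) else 0

/-- The resolvent `(I - τ Δ)⁻¹` on `L²(ℝ^d)`: the inverse of `u ↦ u + τ (-Δ) u` on the domain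
of `-Δ`. -/
def resolvent {d : ℕ} (τ : ℝ) (ψ : L2 d) : L2 d :=
  Function.invFunOn (fun u : L2 d => u + (τ : ℂ) • fracLap 1 u) (fracLapDomain 1) ψ

theorem fourier_fracLap {d : ℕ} {α : ℝ} {f : L2 d} (hf : f ∈ fracLapDomain α) :
    ((𝓕 (fracLap α f) : L2 d) : E d → ℂ) =ᵐ[volume]
      fun ξ => (lapSymbol α ξ : ℂ) * (𝓕 f : L2 d) ξ := by
  have h : MemLp (fun ξ : E d => (lapSymbol α ξ : ℂ) * (𝓕 f : L2 d) ξ) 2 volume := hf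
  rw [fracLap, dif_pos h, FourierTransform.fourier_fourierInv_eq]
  exact h.coeFn_toLp

/-- `I - τ Δ` is a bijection from the domain of `-Δ` onto `L²(ℝ^d)`, so that `resolvent τ` is
its inverse. -/
theorem bijOn_resolvent {d : ℕ} {τ : ℝ} (hτ : 0 < τ) :
    BijOn (fun u : L2 d => u + (τ : ℂ) • fracLap 1 u) (fracLapDomain 1) univ := by
  have hsym : ∀ ξ : E d, lapSymbol 1 ξ = (2 * Real.pi * ‖ξ‖) ^ 2 := fun ξ => by
    rw [lapSymbol, mul_one]; exact Real.rpow_two _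
  have hpos : ∀ ξ : E d, 0 < 1 + τ * lapSymbol 1 ξ := fun ξ => by
    rw [hsym]; positivity
  have hmeas : Measurable (fun ξ : E d => lapSymbol 1 ξ) := by
    simp only [hsym]; fun_prop
  have key : ∀ u : L2 d, u ∈ fracLapDomain 1 →
      ((𝓕 (u + (τ : ℂ) • fracLap 1 u) : L2 d) : E d → ℂ) =ᵐ[volume]
        fun ξ => ((1 + τ * lapSymbol 1 ξ : ℝ) : ℂ) * (𝓕 u : L2 d) ξ := by
    intro u hu
    rw [FourierTransform.fourier_add, FourierTransform.fourier_smul]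
    filter_upwards [fourier_fracLap hu, Lp.coeFn_add (𝓕 u : L2 d) ((τ : ℂ) • 𝓕 (fracLap 1 u)),
      Lp.coeFn_smul (τ : ℂ) (𝓕 (fracLap 1 u) : L2 d)] with ξ h1 h2 h3
    rw [h2, Pi.add_apply, h3, Pi.smul_apply, h1, smul_eq_mul]
    push_cast
    ring
  refine ⟨fun _ _ => mem_univ _, ?_, ?_⟩
  · intro u hu v hv huv
    have hE : (𝓕 u : L2 d) = 𝓕 v := by
      apply Lp.ext
      have huv' : (u + (τ : ℂ) • fracLap 1 u : L2 d) = v + (τ : ℂ) • fracLap 1 v := huv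
      have h2 := key v hv
      rw [← huv'] at h2
      filter_upwards [key u hu, h2] with ξ h1 h2
      have h3 := h1.symm.trans h2
      exact mul_left_cancel₀ (by exact_mod_cast (hpos ξ).ne') h3
    have := congrArg (fun f : L2 d => (𝓕⁻ f : L2 d)) hE
    simpa using this
  · intro ψ _
    have hm : MemLp (fun ξ : E d => (((1 + τ * lapSymbol 1 ξ)⁻¹ : ℝ) : ℂ) * (𝓕 ψ : L2 d) ξ) 2
        volume := by
      refine MemLp.of_le (Lp.memLp (𝓕 ψ : L2 d)) ?_ ?_
      · exact (Complex.measurable_ofReal.comp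
          ((hmeas.const_mul τ).const_add 1).inv).aestronglyMeasurable.mul
          (Lp.aestronglyMeasurable _)
      · refine Filter.Eventually.of_forall fun ξ => ?_
        rw [norm_mul, Complex.norm_real, Real.norm_of_nonneg (inv_nonneg.2 (hpos ξ).le)]
        refine mul_le_of_le_one_left (norm_nonneg _) (inv_le_one_of_one_le₀ ?_)
        rw [hsym]
        have : 0 ≤ τ * (2 * Real.pi * ‖ξ‖) ^ 2 := by positivity
        linarith
    have hFu : ((𝓕 (𝓕⁻ hm.toLp : L2 d) : L2 d) : E d → ℂ) =ᵐ[volume]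
        fun ξ => (((1 + τ * lapSymbol 1 ξ)⁻¹ : ℝ) : ℂ) * (𝓕 ψ : L2 d) ξ := by
      rw [FourierTransform.fourier_fourierInv_eq]
      exact hm.coeFn_toLp
    have hu : (𝓕⁻ hm.toLp : L2 d) ∈ fracLapDomain 1 := by
      change MemLp _ 2 volume
      refine MemLp.of_le ((Lp.memLp (𝓕 ψ : L2 d)).const_mul ((τ⁻¹ : ℝ) : ℂ)) ?_ ?_
      · exact (Complex.measurable_ofReal.comp hmeas).aestronglyMeasurable.mul
          (Lp.aestronglyMeasurable _)
      · filter_upwards [hFu] with ξ h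
        rw [h, ← mul_assoc, norm_mul, norm_mul, norm_mul, Complex.norm_real, Complex.norm_real,
          Complex.norm_real]
        refine mul_le_mul_of_nonneg_right ?_ (norm_nonneg _)
        have h0 : 0 ≤ lapSymbol 1 ξ := by rw [hsym]; positivity
        rw [Real.norm_of_nonneg h0, Real.norm_of_nonneg (inv_nonneg.2 (hpos ξ).le),
          Real.norm_of_nonneg (inv_nonneg.2 hτ.le), ← div_eq_mul_inv, ← one_div,
          div_le_div_iff₀ (hpos ξ) hτ]
        linarith
    refine ⟨𝓕⁻ hm.toLp, hu, ?_⟩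
    have hE : (𝓕 ((𝓕⁻ hm.toLp : L2 d) + (τ : ℂ) • fracLap 1 (𝓕⁻ hm.toLp : L2 d)) : L2 d)
        = 𝓕 ψ := by
      apply Lp.ext
      filter_upwards [key _ hu, hFu] with ξ h1 h2
      rw [h1, h2, ← mul_assoc, ← Complex.ofReal_mul, mul_inv_cancel₀ (hpos ξ).ne',
        Complex.ofReal_one, one_mul]
    have := congrArg (fun f : L2 d => (𝓕⁻ f : L2 d)) hE
    simpa using this

/-- `w(ψ, t) = -t² Δ (I - t² Δ)⁻¹ ψ`. -/
def w {d : ℕ} (ψ : L2 d) (t : ℝ) : L2 d :=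
  ((t ^ 2 : ℝ) : ℂ) • fracLap 1 (resolvent (t ^ 2) ψ)

/-- The bilinear form `a(η, θ)`, the `L²(ℝ^d)` scalar product of `(-Δ)^{s/2} η̃` and
`(-Δ)^{s/2} θ̃` (both functions are real-valued almost everywhere, so that the complex
conjugation in the scalar product has no effect). -/
def a {d : ℕ} (D : TopologicalSpace.Opens (E d)) (s : ℝ) (η θ : L2D D) : ℂ :=
  inner ℂ (fracLap (s / 2) (zeroExt D θ)) (fracLap (s / 2) (zeroExt D η))

/-- The constant `c_s = (∫₀^∞ y^{1-2s} / (1 + y²) dy)⁻¹`. -/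
def cs (s : ℝ) : ℝ := (∫ y in Ioi (0 : ℝ), y ^ (1 - 2 * s) / (1 + y ^ 2))⁻¹

/-- The sinc quadrature approximation `a^k(η, θ)` with spacing `k`, nodes `y_j = jk` and
`t_j = exp (-y_j / 2)` for `-N⁻ ≤ j ≤ N⁺`. -/
def ak {d : ℕ} (D : TopologicalSpace.Opens (E d)) (s k : ℝ) (Nm Np : ℕ) (η θ : L2D D) : ℂ :=
  ((cs s * k / 2 : ℝ) : ℂ) * ∑ j ∈ Finset.Icc (-(Nm : ℤ)) (Np : ℤ),
    ((Real.exp (s * (j * k)) : ℝ) : ℂ) *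
      ∫ x in (D : Set (E d)), w (zeroExt D η) (Real.exp (-(j * k) / 2)) x * (θ x : ℂ)

/-- The square `∫ (1 + |ζ|²)^r |𝓕 f|² dζ` of the norm of `H^r(ℝ^d)`, possibly infinite. -/
def sobolevNormSq {d : ℕ} (r : ℝ) (f : L2 d) : ℝ≥0∞ :=
  ∫⁻ ξ : E d, ENNReal.ofReal ((1 + (2 * Real.pi * ‖ξ‖) ^ 2) ^ r) * ‖(𝓕 f : L2 d) ξ‖ₑ ^ 2

/-- `η` belongs to `H̃^r(D)`: its extension by zero belongs to `H^r(ℝ^d)`. -/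
def MemHTilde {d : ℕ} (D : TopologicalSpace.Opens (E d)) (r : ℝ) (η : L2D D) : Prop :=
  sobolevNormSq r (zeroExt D η) < ⊤

/-- The normalization constant `c_{d,r}` of the fractional Laplacian
`(-Δ)^r η (x) = c_{d,r} PV ∫ (η(x) - η(y)) / |x - y|^{d + 2r} dy`. -/
def cdr (d : ℕ) [NeZero d] (r : ℝ) : ℝ :=
  (∫ h : E d, (1 - Real.cos (h 0)) / ‖h‖ ^ ((d : ℝ) + 2 * r))⁻¹

/-- The double integral `∬ |η̃(x) - η̃(y)|² / |x - y|^{d + 2r} dy dx`, possibly infinite. -/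
def gagliardoSq {d : ℕ} (D : TopologicalSpace.Opens (E d)) (r : ℝ) (η : L2D D) : ℝ≥0∞ :=
  ∫⁻ x : E d, ∫⁻ y : E d, ENNReal.ofReal
    ((zeroExtFun D η x - zeroExtFun D η y) ^ 2 / ‖x - y‖ ^ ((d : ℝ) + 2 * r))

/-- The norm of `H̃^r(D)`: for `0 < r < 1` the normalized double-integral norm
`((c_{d,r} / 2) ∬ |η̃(x) - η̃(y)|² / |x - y|^{d + 2r} dy dx)^{1/2}`, scaled so that its square is
`a(η, η)` for `r = s`, and for `1 ≤ r < 2` the norm of `H^r(ℝ^d)` of the extension by zero. -/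
def normHTilde {d : ℕ} [NeZero d] (D : TopologicalSpace.Opens (E d)) (r : ℝ) (η : L2D D) : ℝ :=
  if r < 1 then Real.sqrt (cdr d r / 2 * (gagliardoSq D r η).toReal)
  else Real.sqrt (sobolevNormSq r (zeroExt D η)).toReal

/-- `c(𝖽) = 1 / √((1 + cos 𝖽) / 2)`. -/
def cBand (b : ℝ) : ℝ := 1 / Real.sqrt ((1 + Real.cos b) / 2)

end SincQuad

end

namespace SincQuad

/-! On the Fourier side both forms are integrals of a symbol in `l = |ζ|²` against `𝓕 η̃ · conj (𝓕
θ̃)`: the symbol of `a` is `l ^ s`, and that of `ak` is the truncated sum of `e^{sy} l / (e^y + l)`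
over the nodes (`a_eq_integral`, `ak_eq_integral`). It therefore suffices to bound the difference of
symbols by `A l^{(δ+s)/2} + B` (`abs_rpow_sub_sinc_le`); Cauchy-Schwarz then yields the two products
of norms (`norm_integral_symbol_le`).

For the scalar bound, put `φ(u) = e^{su} / (1 + e^u)`. The summand is `l^s φ(y - log l)`, so `l`
enters only as a prefactor and a shift of the grid. Poisson summation turns the error of the
infinite trapezoidal rule into the sum of the nonzero Fourier modes of `φ`, and a shift only changes
their phases (`abs_pi_div_sin_sub_tsum_le`). The transform of `φ` is `π / sin(π(s - iω))`, with
modulus at most `π / (sin(πs) cosh(πω))`. The inequality `cos(b/2) e^{b|ω|} ≤ cosh(πω)` produces the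
constant `cBand b` and the rate `e^{-2πb/k}`. The discarded tails are dominated by geometric series.

The weighted integrals of `|𝓕 η̃|²` are controlled by `normHTilde` through Plancherel applied to
translation differences, which identifies the double integral (`gagliardoSq_eq`). -/

/-! ### A sharp exponential lower bound for the hyperbolic cosine. -/

theorem arctan_le_tanh {u : ℝ} (hu : 0 ≤ u) :
    Real.arctan u ≤ Real.pi / 2 * Real.tanh (Real.pi / 2 * u) := by
  have hpi := Real.pi_gt_three
  have h0 : 0 ≤ Real.arctan u := Real.arctan_nonneg.2 hu
  -- Jordan's inequality for the sine, at the angle `arctan u`.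
  have h1 : 2 / Real.pi * Real.arctan u ≤ u / Real.sqrt (1 + u ^ 2) := by
    rw [← Real.sin_arctan]
    exact Real.mul_le_sin h0 (Real.arctan_lt_pi_div_two u).le
  have h2 : Real.arctan u ≤ Real.pi / 2 * (u / Real.sqrt (1 + u ^ 2)) := by
    have := mul_le_mul_of_nonneg_left h1 (by positivity : 0 ≤ Real.pi / 2)
    rwa [← mul_assoc, show Real.pi / 2 * (2 / Real.pi) = 1 by field_simp, one_mul] at this
  refine h2.trans (mul_le_mul_of_nonneg_left ?_ (by positivity))
  set x := Real.pi / 2 * u with hx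
  -- Since `tanh x = sinh x / √(1 + sinh² x)` and `v / √(1 + v²)` increases, comparing `u` with
  -- `sinh x` is enough.
  have hux : u ≤ Real.sinh x := by
    have hxu : u ≤ x := by nlinarith
    exact hxu.trans (Real.self_le_sinh_iff.2 (hu.trans hxu))
  rw [Real.tanh_eq_sinh_div_cosh, div_le_div_iff₀ (by positivity) (Real.cosh_pos x)]
  have hs0 : 0 ≤ Real.sinh x := hu.trans hux
  refine abs_le_of_sq_le_sq' ?_ (by positivity) |>.2
  rw [mul_pow, mul_pow, Real.sq_sqrt (by positivity), Real.cosh_sq]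
  nlinarith [pow_le_pow_left₀ hu hux 2]

/-- Both sides vanish at `0`, and their derivatives are compared in `arctan_le_tanh`. -/
theorem mul_arctan_sub_log_le_log_cosh {u : ℝ} (hu : 0 ≤ u) :
    u * Real.arctan u - Real.log (1 + u ^ 2) / 2 ≤ Real.log (Real.cosh (Real.pi / 2 * u)) := by
  let H : ℝ → ℝ := fun v => Real.log (Real.cosh (Real.pi / 2 * v)) -
    (v * Real.arctan v - Real.log (1 + v ^ 2) / 2)
  have hd : ∀ v, HasDerivAt H (Real.pi / 2 * Real.tanh (Real.pi / 2 * v) - Real.arctan v) v := by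
    intro v
    have hp : (1 + v ^ 2 : ℝ) ≠ 0 := by positivity
    have h1 := ((Real.hasDerivAt_cosh (Real.pi / 2 * v)).comp v
      ((hasDerivAt_id v).const_mul (Real.pi / 2))).log (Real.cosh_pos _).ne'
    have h2 := ((hasDerivAt_id v).mul (Real.hasDerivAt_arctan v))
    have h3 := ((((hasDerivAt_id v).pow 2).const_add 1).log hp).div_const 2
    refine (h1.sub (h2.sub h3)).congr_deriv ?_
    simp only [id, Function.comp, Real.tanh_eq_sinh_div_cosh]
    have := (Real.cosh_pos (Real.pi / 2 * v)).ne'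
    simp
    field_simp
    ring
  have hmono : MonotoneOn H (Ici 0) := by
    refine monotoneOn_of_deriv_nonneg (convex_Ici 0)
      (fun v _ => (hd v).continuousAt.continuousWithinAt)
      (fun v _ => (hd v).differentiableAt.differentiableWithinAt) fun v hv => ?_
    rw [interior_Ici] at hv
    rw [(hd v).deriv]
    linarith [arctan_le_tanh (le_of_lt hv)]
  have := hmono self_mem_Ici hu hu
  simp only [H] at this
  simp at this
  linarith

/-- Legendre duality: `u arctan u - log(1 + u²)/2` is the supremum of `a u + log cos a` over `|a| <
π/2`, so the previous lemma gives all values of `a` at once. The crude bound `e^x / 2 ≤ cosh x`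
would not give the factor `cos a` when `a` is small. -/
theorem cos_mul_exp_le_cosh {a u : ℝ} (ha0 : 0 ≤ a) (ha : a < Real.pi / 2) (hu : 0 ≤ u) :
    Real.cos a * Real.exp (a * u) ≤ Real.cosh (Real.pi / 2 * u) := by
  have hcos : 0 < Real.cos a := Real.cos_pos_of_mem_Ioo ⟨by linarith, ha⟩
  let K : ℝ → ℝ := fun v => v * Real.arctan v - Real.log (1 + v ^ 2) / 2 - a * v
  have hd : ∀ v, HasDerivAt K (Real.arctan v - a) v := by
    intro v
    have hp : (1 + v ^ 2 : ℝ) ≠ 0 := by positivity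
    have h2 := ((hasDerivAt_id v).mul (Real.hasDerivAt_arctan v))
    have h3 := ((((hasDerivAt_id v).pow 2).const_add 1).log hp).div_const 2
    refine ((h2.sub h3).sub ((hasDerivAt_id v).const_mul a)).congr_deriv ?_
    simp
    field_simp
    ring
  have hconv : ConvexOn ℝ univ K := by
    refine MonotoneOn.convexOn_of_deriv convex_univ
      (fun v _ => (hd v).continuousAt.continuousWithinAt)
      (fun v _ => (hd v).differentiableAt.differentiableWithinAt) ?_
    intro v _ w _ hvw
    rw [(hd v).deriv, (hd w).deriv]
    linarith [Real.arctan_mono hvw]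
  have hta : Real.arctan (Real.tan a) = a := Real.arctan_tan (by linarith) ha
  -- `K' = arctan - a` vanishes at `tan a`, and the minimum value of the convex function `K` is `log
  -- cos a`.
  have hmin : IsMinOn K univ (Real.tan a) := by
    have h := (hd (Real.tan a)).hasDerivWithinAt.derivWithin (uniqueDiffWithinAt_Ioi _)
    rw [hta, sub_self] at h
    exact hconv.isMinOn_of_rightDeriv_eq_zero (by simp) h
  have hK : K (Real.tan a) = Real.log (Real.cos a) := by
    simp only [K, hta]
    have : 1 + Real.tan a ^ 2 = (Real.cos a ^ 2)⁻¹ := (Real.inv_one_add_tan_sq hcos.ne' ▸ (inv_inv _).symm)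
    rw [this, Real.log_inv, Real.log_pow]
    push_cast; ring
  have h1 := hmin (mem_univ u)
  simp only [mem_ofPred_eq, hK] at h1
  have h2 := mul_arctan_sub_log_le_log_cosh hu
  simp only [K] at h1
  rw [← Real.exp_log hcos, ← Real.exp_add, ← Real.exp_log (Real.cosh_pos (Real.pi / 2 * u))]
  apply Real.exp_le_exp.2
  linarith

/-! ### The kernel integral and the constant `cs`. -/

/-- The sigmoid substitution maps the line onto `(0, 1)` and turns the Beta integral `B(z, 1 - z)`
into this one; the reflection formula evaluates it. Complex `z` is needed because the imaginary part
carries the frequency of the Fourier transform. -/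
theorem integral_cexp_div_one_add_exp {z : ℂ} (h0 : 0 < z.re) (h1 : z.re < 1) :
    ∫ y : ℝ, Complex.exp (z * y) / (1 + Real.exp y : ℝ) = Real.pi / Complex.sin (Real.pi * z) := by
  have hb : Complex.betaIntegral z (1 - z) = Real.pi / Complex.sin (Real.pi * z) := by
    have := Complex.Gamma_mul_Gamma_eq_betaIntegral h0 (t := 1 - z) (by simpa using h1)
    rw [add_sub_cancel, Complex.Gamma_one, one_mul, Complex.Gamma_mul_Gamma_one_sub] at this
    exact this.symm
  rw [← hb, Complex.betaIntegral, intervalIntegral.integral_of_le zero_le_one,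
    integral_Ioc_eq_integral_Ioo, ← Real.range_sigmoid, ← image_univ,
    integral_image_eq_integral_abs_deriv_smul MeasurableSet.univ
      (fun x _ => (Real.hasDerivAt_sigmoid x).hasDerivWithinAt) Real.sigmoid_injective.injOn,
    setIntegral_univ]
  congr 1 with y
  have hp := Real.sigmoid_pos y
  have hm : 0 < 1 - Real.sigmoid y := by linarith [Real.sigmoid_lt_one y]
  have hE := Real.exp_pos y
  have hs : Real.sigmoid y = Real.exp y * (1 + Real.exp y)⁻¹ := by
    rw [Real.sigmoid_def, Real.exp_neg]; field_simp; ring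
  have hs' : 1 - Real.sigmoid y = (1 + Real.exp y)⁻¹ := by
    rw [hs]; field_simp; ring
  have hl : Real.log (Real.sigmoid y) - Real.log (1 - Real.sigmoid y) = y := by
    rw [← Real.log_div hp.ne' hm.ne', hs', hs, mul_div_assoc, div_self (by positivity), mul_one, Real.log_exp]
  rw [abs_of_pos (mul_pos hp hm), ← Complex.ofReal_one, ← Complex.ofReal_sub,
    Complex.cpow_def_of_ne_zero (by exact_mod_cast hp.ne'),
    Complex.cpow_def_of_ne_zero (by exact_mod_cast hm.ne'), ← Complex.ofReal_log hp.le,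
    ← Complex.ofReal_log hm.le, Complex.real_smul, ← Real.exp_log (mul_pos hp hm),
    Real.log_mul hp.ne' hm.ne', Complex.ofReal_exp, ← Complex.exp_add, ← Complex.exp_add,
    div_eq_mul_inv, ← Complex.ofReal_inv, ← hs', ← Real.exp_log hm, Complex.ofReal_exp,
    ← Complex.exp_add, Real.log_exp]
  congr 1
  have hl' : (y : ℂ) = Real.log (Real.sigmoid y) - Real.log (1 - Real.sigmoid y) := by
    rw [← Complex.ofReal_sub, hl]
  rw [hl']
  push_cast
  ring

theorem integral_exp_div_one_add_exp {s : ℝ} (h0 : 0 < s) (h1 : s < 1) :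
    ∫ y : ℝ, Real.exp (s * y) / (1 + Real.exp y) = Real.pi / Real.sin (Real.pi * s) := by
  have := integral_cexp_div_one_add_exp (z := s) (by simpa) (by simpa)
  rw [← Complex.ofReal_inj, ← integral_complex_ofReal]
  push_cast at this ⊢
  exact this

/-- Substituting `y = e^{x/2}` reduces the integral to half the kernel integral with parameter `1 -
s`. -/
theorem cs_eq {s : ℝ} (hs : s ∈ Ioo (0 : ℝ) 1) : cs s = 2 * Real.sin (Real.pi * s) / Real.pi := by
  have hr : (Ioi 0 : Set ℝ) = (fun x : ℝ => Real.exp (x / 2)) '' univ := by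
    ext y
    simp only [mem_Ioi, image_univ, mem_range]
    refine ⟨fun hy => ⟨2 * Real.log y, ?_⟩, ?_⟩
    · rw [mul_div_cancel_left₀ _ two_ne_zero, Real.exp_log hy]
    · rintro ⟨x, rfl⟩; positivity
  have hd : ∀ x : ℝ, HasDerivAt (fun x : ℝ => Real.exp (x / 2)) (Real.exp (x / 2) / 2) x := by
    intro x
    refine ((hasDerivAt_id x).div_const 2).exp.congr_deriv ?_
    simp [div_eq_mul_inv]
  have hinj : Function.Injective fun x : ℝ => Real.exp (x / 2) := by
    intro x y h
    have := Real.exp_injective h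
    linarith
  have := integral_exp_div_one_add_exp (s := 1 - s) (by linarith [hs.2]) (by linarith [hs.1])
  rw [cs, hr, integral_image_eq_integral_abs_deriv_smul MeasurableSet.univ
      (fun x _ => (hd x).hasDerivWithinAt) hinj.injOn, setIntegral_univ]
  have h2 : (fun x : ℝ => |Real.exp (x / 2) / 2| • (Real.exp (x / 2) ^ (1 - 2 * s) /
      (1 + Real.exp (x / 2) ^ 2))) = fun x => (1 / 2) * (Real.exp ((1 - s) * x) / (1 + Real.exp x)) := by
    ext x
    rw [abs_of_pos (by positivity), ← Real.exp_mul, ← Real.exp_nat_mul, smul_eq_mul,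
      show (1 - s) * x = x / 2 + x / 2 * (1 - 2 * s) by ring, Real.exp_add,
      show ((2 : ℕ) : ℝ) * (x / 2) = x by push_cast; ring]
    ring
  rw [h2, integral_const_mul, this, show Real.pi * (1 - s) = Real.pi - Real.pi * s by ring,
    Real.sin_pi_sub]
  have := Real.pi_ne_zero
  simp
  ring

theorem cBand_eq {b : ℝ} (hb : b ∈ Ioo (0 : ℝ) Real.pi) :
    0 < Real.cos (b / 2) ∧ cBand b = 1 / Real.cos (b / 2) := by
  have hcos : 0 < Real.cos (b / 2) :=
    Real.cos_pos_of_mem_Ioo ⟨by linarith [hb.1, Real.pi_pos], by linarith [hb.2]⟩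
  refine ⟨hcos, ?_⟩
  rw [cBand, Real.cos_half (by linarith [hb.1, hb.2]) (by linarith [hb.2])]

theorem one_le_cBand {b : ℝ} (hb : b ∈ Ioo (0 : ℝ) Real.pi) : 1 ≤ cBand b := by
  obtain ⟨h, h'⟩ := cBand_eq hb
  rw [h', one_le_div h]
  exact Real.cos_le_one _

/-! ### Trapezoidal rule on the whole line. -/

/-- The kernel behaves like `e^{sy}` at `-∞` and `e^{(s-1)y}` at `+∞`, so every intermediate rate
dominates it. The free exponent `p` lets one estimate serve both the decay needed for Poisson
summation and the two truncation tails. -/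
theorem exp_div_one_add_exp_le {s y p : ℝ} (h0 : s - 1 ≤ p) (h1 : p ≤ s) :
    Real.exp (s * y) / (1 + Real.exp y) ≤ Real.exp (p * y) := by
  rw [div_le_iff₀ (by positivity)]
  rcases le_total 0 y with hy | hy
  · have : Real.exp (s * y) ≤ Real.exp (p * y) * Real.exp y := by
      rw [← Real.exp_add]; exact Real.exp_le_exp.2 (by nlinarith)
    nlinarith [Real.exp_pos (p * y)]
  · have : Real.exp (s * y) ≤ Real.exp (p * y) := Real.exp_le_exp.2 (by nlinarith)
    nlinarith [Real.exp_pos (p * y), Real.exp_pos y]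

theorem exp_neg_abs_le {c x : ℝ} (hc : 0 < c) (hx : x ≠ 0) :
    Real.exp (-(c * |x|)) ≤ 2 / c ^ 2 * |x| ^ (-2 : ℝ) := by
  have hx' : 0 < |x| := abs_pos.2 hx
  have h := Real.pow_div_factorial_le_exp (c * |x|) (by positivity) 2
  rw [Real.exp_neg, Real.rpow_neg hx'.le, Real.rpow_two, ← div_eq_mul_inv, div_div, ← mul_pow,
    ← inv_div]
  refine inv_anti₀ (by positivity) ?_
  simpa using h

theorem fourier_exp_div_one_add_exp {s k : ℝ} (hs : s ∈ Ioo (0 : ℝ) 1) (hk : 0 < k) (w : ℝ) :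
    𝓕 (fun u : ℝ => ((Real.exp (s * (k * u)) / (1 + Real.exp (k * u)) : ℝ) : ℂ)) w =
      (k⁻¹ : ℝ) * (Real.pi / Complex.sin (Real.pi * (s - 2 * Real.pi * w / k * Complex.I))) := by
  rw [Real.fourier_real_eq_integral_exp_smul, ← integral_cexp_div_one_add_exp
    (z := s - 2 * Real.pi * w / k * Complex.I)]
  · have := Measure.integral_comp_mul_left (fun y : ℝ =>
      Complex.exp ((s - 2 * Real.pi * w / k * Complex.I) * y) / (1 + Real.exp y : ℝ)) k
    rw [abs_of_pos (inv_pos.2 hk), Complex.real_smul] at this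
    rw [← this]
    congr 1 with v
    rw [smul_eq_mul, Complex.ofReal_div, Complex.ofReal_exp, mul_div_assoc', ← Complex.exp_add]
    congr 2
    have : (k : ℂ) ≠ 0 := by exact_mod_cast hk.ne'
    push_cast
    field_simp
    ring
  all_goals
    rw [show 2 * (Real.pi : ℂ) * w / k * Complex.I = ((2 * Real.pi * w / k : ℝ) : ℂ) * Complex.I by
      push_cast; ring]
    simp [hs.1, hs.2]

theorem norm_pi_div_sin_le {s ω b : ℝ} (hs : s ∈ Ioo (0 : ℝ) 1) (hb : b ∈ Ioo (0 : ℝ) Real.pi) :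
    ‖(Real.pi : ℂ) / Complex.sin (Real.pi * (s - ω * Complex.I))‖ ≤
      Real.pi / Real.sin (Real.pi * s) * cBand b * Real.exp (-(b * |ω|)) := by
  have hpi := Real.pi_pos
  have hsin : 0 < Real.sin (Real.pi * s) :=
    Real.sin_pos_of_pos_of_lt_pi (mul_pos hpi hs.1) (by nlinarith [hs.2])
  obtain ⟨hcos, hcb⟩ := cBand_eq hb
  -- The left side is the real part of the complex sine.
  have h1 : Real.sin (Real.pi * s) * Real.cosh (Real.pi * ω) ≤
      ‖Complex.sin (Real.pi * (s - ω * Complex.I))‖ := by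
    refine le_trans (le_of_eq ?_) ((le_abs_self _).trans (Complex.abs_re_le_norm _))
    rw [show (Real.pi : ℂ) * (s - ω * Complex.I) =
      ((Real.pi * s : ℝ) : ℂ) + ((-(Real.pi * ω) : ℝ) : ℂ) * Complex.I by push_cast; ring,
      Complex.sin_add_mul_I, ← Complex.ofReal_sin, ← Complex.ofReal_cos, ← Complex.ofReal_sinh,
      ← Complex.ofReal_cosh, ← Complex.ofReal_mul, ← Complex.ofReal_mul, Real.cosh_neg]
    rw [Complex.add_re, Complex.ofReal_re, Complex.re_ofReal_mul, Complex.I_re, mul_zero, add_zero]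
  have h2 := cos_mul_exp_le_cosh (a := b / 2) (u := 2 * |ω|) (by linarith [hb.1])
    (by linarith [hb.2]) (by positivity)
  rw [show Real.pi / 2 * (2 * |ω|) = |Real.pi * ω| by rw [abs_mul, abs_of_pos hpi]; ring,
    Real.cosh_abs, show b / 2 * (2 * |ω|) = b * |ω| by ring] at h2
  rw [norm_div, Complex.norm_real, Real.norm_of_nonneg hpi.le, hcb, Real.exp_neg]
  calc Real.pi / ‖Complex.sin (Real.pi * (s - ω * Complex.I))‖
      ≤ Real.pi / (Real.sin (Real.pi * s) * (Real.cos (b / 2) * Real.exp (b * |ω|))) := by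
        refine div_le_div_of_nonneg_left hpi.le (by positivity) (le_trans ?_ h1)
        gcongr
    _ = _ := by field_simp

theorem hasSum_int_geometric {q : ℝ} (h0 : 0 ≤ q) (h1 : q < 1) :
    HasSum (fun n : ℤ => if n = 0 then 0 else q ^ n.natAbs) (2 * (q / (1 - q))) := by
  have hg : HasSum (fun n : ℕ => q ^ (n + 1)) (q / (1 - q)) := by
    simpa [pow_succ, div_eq_mul_inv, mul_comm] using (hasSum_geometric_of_lt_one h0 h1).mul_right q
  have h := HasSum.of_nat_of_neg_add_one (f := fun n : ℤ => if n = 0 then 0 else q ^ n.natAbs)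
    (m := q / (1 - q)) (m' := q / (1 - q)) ?_ ?_
  · rwa [two_mul]
  · refine (hasSum_nat_add_iff' 1).1 ?_
    simp only [Finset.range_one, Finset.sum_singleton, Nat.cast_zero, if_true, sub_zero]
    convert! hg using 1
  · convert! hg using 1

/-- Error of the trapezoidal rule on the whole line for `exp (s y) / (1 + exp y)`, by Poisson
summation. -/
theorem abs_pi_div_sin_sub_tsum_le {s k b : ℝ} (hs : s ∈ Ioo (0 : ℝ) 1) (hk : 0 < k)
    (hb : b ∈ Ioo (0 : ℝ) Real.pi) (x : ℝ) :
    |Real.pi / Real.sin (Real.pi * s) -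
      k * ∑' j : ℤ, Real.exp (s * (j * k + x)) / (1 + Real.exp (j * k + x))| ≤
      Real.pi / Real.sin (Real.pi * s) * cBand b * (2 / (Real.exp (2 * Real.pi * b / k) - 1)) := by
  have hpi := Real.pi_pos
  have hsin : 0 < Real.sin (Real.pi * s) :=
    Real.sin_pos_of_pos_of_lt_pi (mul_pos hpi hs.1) (by nlinarith [hs.2])
  set f : ℝ → ℂ := fun u => ((Real.exp (s * (k * u)) / (1 + Real.exp (k * u)) : ℝ) : ℂ) with hf
  set q := Real.exp (-(2 * Real.pi * b / k)) with hq
  have hb0 : 0 < 2 * Real.pi * b / k := by have := hb.1; positivity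
  have hq1 : q < 1 := Real.exp_lt_one_iff.2 (by linarith)
  have hgeo := hasSum_int_geometric (q := q) (Real.exp_pos _).le hq1
  have hqq : q / (1 - q) = 1 / (Real.exp (2 * Real.pi * b / k) - 1) := by
    have : Real.exp (2 * Real.pi * b / k) - 1 ≠ 0 := by
      have := Real.add_one_lt_exp hb0.ne'; linarith
    have h2 : 1 - q ≠ 0 := by linarith
    rw [div_eq_div_iff h2 this, hq, Real.exp_neg]
    field_simp
  set C := Real.pi / Real.sin (Real.pi * s) * cBand b with hC
  have hF : ∀ n : ℤ, ‖𝓕 f n‖ ≤ k⁻¹ * (C * q ^ n.natAbs) := by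
    intro n
    rw [hf, fourier_exp_div_one_add_exp hs hk, norm_mul, Complex.norm_real,
      Real.norm_of_nonneg (inv_nonneg.2 hk.le)]
    refine mul_le_mul_of_nonneg_left ?_ (inv_nonneg.2 hk.le)
    have := norm_pi_div_sin_le (ω := 2 * Real.pi * n / k) hs hb
    push_cast at this ⊢
    refine this.trans (le_of_eq ?_)
    rw [hC, hq, ← Real.exp_nat_mul, Nat.cast_natAbs, Int.cast_abs, abs_div, abs_mul, abs_of_pos hk,
      abs_of_pos (by positivity : 0 < 2 * Real.pi)]
    congr 2
    ring
  have hsum' : Summable fun n : ℤ => q ^ n.natAbs := by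
    refine (hasSum_ite_eq (0 : ℤ) (1 : ℝ)).summable.add hgeo.summable |>.congr fun n => ?_
    by_cases hn : n = 0 <;> simp [hn]
  have hFs : Summable fun n : ℤ => 𝓕 f n :=
    Summable.of_norm_bounded ((hsum'.mul_left C).mul_left k⁻¹) hF
  have hcont : Continuous f := by
    refine Complex.continuous_ofReal.comp (Continuous.div (by fun_prop) (by fun_prop) fun u => ?_)
    positivity
  -- Poisson summation only asks for a power decay of order above `1`; the exponential decay at rate
  -- `min s (1 - s) * k` gives order `2`.
  have hdecay : f =O[Filter.cocompact ℝ] fun u : ℝ => |u| ^ (-2 : ℝ) := by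
    set c := min s (1 - s) * k
    have hc : 0 < c := mul_pos (lt_min hs.1 (by linarith [hs.2])) hk
    refine Asymptotics.IsBigO.of_bound (2 / c ^ 2) ?_
    filter_upwards [(isCompact_singleton (x := (0 : ℝ))).compl_mem_cocompact] with u hu
    rw [hf, Complex.norm_real, Real.norm_of_nonneg (by positivity),
      Real.norm_of_nonneg (by positivity)]
    refine le_trans ?_ (exp_neg_abs_le hc hu)
    have hm1 := min_le_left s (1 - s)
    have hm2 := min_le_right s (1 - s)
    have hm0 : 0 < min s (1 - s) := lt_min hs.1 (by linarith [hs.2])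
    rcases le_total 0 u with h | h
    · refine (exp_div_one_add_exp_le (p := -min s (1 - s)) (by linarith) (by linarith)).trans
        (le_of_eq ?_)
      rw [abs_of_nonneg h]; congr 1; ring
    · refine (exp_div_one_add_exp_le (p := min s (1 - s)) (by linarith) (by linarith)).trans
        (le_of_eq ?_)
      rw [abs_of_nonpos h]; congr 1; ring
  have hP := Real.tsum_eq_tsum_fourier_of_rpow_decay_of_summable hcont one_lt_two hdecay hFs (x / k)
  -- The shift `x` enters only through unimodular factors, so the bound is uniform in `x`.
  have hnf : ∀ n : ℤ, ‖𝓕 f n * fourier n ((x / k : ℝ) : UnitAddCircle)‖ = ‖𝓕 f n‖ := by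
    intro n
    rw [norm_mul, fourier_apply, Circle.norm_coe, mul_one]
  have hsumm : Summable fun n : ℤ => 𝓕 f n * fourier n ((x / k : ℝ) : UnitAddCircle) :=
    Summable.of_norm_bounded ((hsum'.mul_left C).mul_left k⁻¹) fun n => (hnf n).le.trans (hF n)
  rw [hsumm.tsum_eq_add_tsum_ite 0] at hP
  have h0 : 𝓕 f ((0 : ℤ) : ℝ) * fourier 0 ((x / k : ℝ) : UnitAddCircle) =
      ((k⁻¹ * (Real.pi / Real.sin (Real.pi * s)) : ℝ) : ℂ) := by
    rw [hf, fourier_exp_div_one_add_exp hs hk]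
    simp
  have hrest : ‖∑' n : ℤ, if n = 0 then 0 else
      𝓕 f n * fourier n ((x / k : ℝ) : UnitAddCircle)‖ ≤ k⁻¹ * (C * (2 * (q / (1 - q)))) := by
    refine tsum_of_norm_bounded ((hgeo.mul_left C).mul_left k⁻¹) fun n => ?_
    by_cases hn : n = 0
    · simp [hn]
    · rw [if_neg hn, if_neg hn, hnf]
      exact hF n
  have hl : (∑' n : ℤ, f (x / k + n)) =
      ((∑' j : ℤ, Real.exp (s * (j * k + x)) / (1 + Real.exp (j * k + x)) : ℝ) : ℂ) := by
    rw [Complex.ofReal_tsum]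
    refine tsum_congr fun n => ?_
    rw [hf]
    have : k * (x / k + n) = n * k + x := by field_simp; ring
    simp only [this]
  rw [hl, h0] at hP
  have hR : (∑' n : ℤ, if n = 0 then 0 else
      𝓕 f n * fourier n ((x / k : ℝ) : UnitAddCircle)) =
      ((∑' j : ℤ, Real.exp (s * (j * k + x)) / (1 + Real.exp (j * k + x)) -
        k⁻¹ * (Real.pi / Real.sin (Real.pi * s)) : ℝ) : ℂ) := by
    rw [Complex.ofReal_sub, hP]; ring
  rw [hR, Complex.norm_real, Real.norm_eq_abs, hqq] at hrest
  set S := ∑' j : ℤ, Real.exp (s * (j * k + x)) / (1 + Real.exp (j * k + x))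
  calc |Real.pi / Real.sin (Real.pi * s) - k * S|
      = k * |S - k⁻¹ * (Real.pi / Real.sin (Real.pi * s))| := by
        rw [← abs_of_pos hk, ← abs_mul, abs_sub_comm, abs_of_pos hk]
        congr 1; field_simp
    _ ≤ k * (k⁻¹ * (C * (2 * (1 / (Real.exp (2 * Real.pi * b / k) - 1))))) := by gcongr
    _ = _ := by field_simp

/-! ### Truncation and the scalar quadrature error. -/

/-- A geometric tail starting at index `N + 1`: the leading factor left after extracting `e^{-aNk}`
is `k / (e^{ak} - 1) ≤ 1 / a`, uniformly in `k`. -/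
theorem summable_exp_and_tsum_le {a k : ℝ} (ha : 0 < a) (hk : 0 < k) (N : ℕ) :
    Summable (fun m : ℕ => Real.exp (-(a * k * (m + N + 1)))) ∧
      k * ∑' m : ℕ, Real.exp (-(a * k * (m + N + 1))) ≤ Real.exp (-(a * N * k)) / a := by
  set q := Real.exp (-(a * k)) with hq
  have hak : 0 < a * k := mul_pos ha hk
  have hq1 : q < 1 := Real.exp_lt_one_iff.2 (by linarith)
  have hq0 : 0 < q := Real.exp_pos _
  have h := (hasSum_geometric_of_lt_one hq0.le hq1).mul_left (Real.exp (-(a * N * k)) * q)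
  have hfun : (fun m : ℕ => Real.exp (-(a * k * (m + N + 1)))) =
      fun m : ℕ => Real.exp (-(a * N * k)) * q * q ^ m := by
    ext m
    rw [hq, ← Real.exp_nat_mul, ← Real.exp_add, ← Real.exp_add]
    congr 1; ring
  rw [hfun]
  refine ⟨h.summable, ?_⟩
  rw [h.tsum_eq]
  have key : k * (q * (1 - q)⁻¹) ≤ 1 / a := by
    have h1 := Real.add_one_le_exp (a * k)
    have h2 : q * Real.exp (a * k) = 1 := by rw [hq, ← Real.exp_add]; simp
    rw [← div_eq_mul_inv, ← mul_div_assoc, div_le_div_iff₀ (by linarith) ha]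
    nlinarith
  calc _ = Real.exp (-(a * N * k)) * (k * (q * (1 - q)⁻¹)) := by ring
    _ ≤ Real.exp (-(a * N * k)) * (1 / a) := by gcongr
    _ = _ := by ring

theorem sum_Icc_neg_eq {M : Type*} [AddCommMonoid M] (f : ℤ → M) (m n : ℕ) :
    ∑ j ∈ Finset.Icc (-(m : ℤ)) n, f j =
      ∑ i ∈ Finset.range (n + 1), f i + ∑ i ∈ Finset.range m, f (-(i + 1)) := by
  rw [← Finset.sum_image (f := f) (g := fun i : ℕ => (i : ℤ)) (by intro a _ b _ h; simpa using h),
    ← Finset.sum_image (f := f) (g := fun i : ℕ => -((i : ℤ) + 1))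
      (by intro a _ b _ h; simpa using h),
    ← Finset.sum_union]
  · congr 1
    ext j
    simp only [Finset.mem_Icc, Finset.mem_union, Finset.mem_image, Finset.mem_range]
    constructor
    · rintro ⟨h1, h2⟩
      rcases le_or_gt 0 j with h | h
      · exact Or.inl ⟨j.toNat, by lia, by lia⟩
      · exact Or.inr ⟨(-j - 1).toNat, by lia, by lia⟩
    · rintro (⟨i, hi, rfl⟩ | ⟨i, hi, rfl⟩) <;> constructor <;> lia
  · rw [Finset.disjoint_left]
    simp only [Finset.mem_image, Finset.mem_range]
    rintro _ ⟨i, hi, rfl⟩ ⟨l, hl, h⟩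
    lia

/-- The scalar quadrature error of the sinc quadrature for `l ^ s`. -/
theorem abs_rpow_sub_sinc_le {s δ b k l : ℝ} (hs : s ∈ Ioo (0 : ℝ) 1) (hδ : δ ∈ Ioc s (2 - s))
    (hb : b ∈ Ioo (0 : ℝ) Real.pi) (hk : 0 < k) (Nm Np : ℕ) (hl : 0 < l) :
    |l ^ s - cs s * k / 2 * ∑ j ∈ Finset.Icc (-(Nm : ℤ)) (Np : ℤ),
        Real.exp (s * (j * k)) * (l / (Real.exp (j * k) + l))| ≤
      2 * cBand b / (δ - s) *
          (2 / (Real.exp (2 * Real.pi * b / k) - 1) + Real.exp ((s - δ) * Np * k / 2)) *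
          l ^ ((δ + s) / 2) +
        cBand b / s *
          (2 / (Real.exp (2 * Real.pi * b / k) - 1) + Real.exp (-s * Nm * k)) := by
  have hpi := Real.pi_pos
  obtain ⟨hs0, hs1⟩ := hs
  obtain ⟨hδ0, hδ1⟩ := hδ
  have hsin : 0 < Real.sin (Real.pi * s) :=
    Real.sin_pos_of_pos_of_lt_pi (mul_pos hpi hs0) (by nlinarith)
  have hc1 := one_le_cBand hb
  set c := cBand b
  set σ := cs s / 2 with hσ
  have hσe : σ = Real.sin (Real.pi * s) / Real.pi := by
    rw [hσ, cs_eq ⟨hs0, hs1⟩]; ring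
  have hσ0 : 0 < σ := by rw [hσe]; positivity
  have hσ1 : σ ≤ 1 := by
    rw [hσe, div_le_one hpi]; linarith [Real.sin_le_one (Real.pi * s), Real.pi_gt_three]
  set Q := 2 / (Real.exp (2 * Real.pi * b / k) - 1) with hQ
  have hQ0 : 0 ≤ Q := by
    have : 0 ≤ 2 * Real.pi * b / k := by have := hb.1; positivity
    have := Real.one_le_exp this
    exact div_nonneg two_pos.le (by linarith)
  set g : ℤ → ℝ := fun j => Real.exp (s * (j * k)) * (l / (Real.exp (j * k) + l)) with hg
  have hg0 : ∀ j, 0 ≤ g j := fun j => by positivity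
  have hel : Real.exp (Real.log l) = l := Real.exp_log hl
  -- Scaling out `l` leaves the fixed kernel on a grid shifted by `-log l`.
  have hgG : ∀ j : ℤ, g j = l ^ s * (Real.exp (s * (j * k + -Real.log l)) /
      (1 + Real.exp (j * k + -Real.log l))) := by
    intro j
    have h1 : Real.exp (j * k + -Real.log l) = Real.exp (j * k) / l := by
      rw [Real.exp_add, Real.exp_neg, hel]; rfl
    have h2 : Real.exp (s * (j * k + -Real.log l)) = Real.exp (s * (j * k)) / l ^ s := by
      rw [mul_add, Real.exp_add, Real.rpow_def_of_pos hl, mul_neg, Real.exp_neg, mul_comm s (Real.log l)]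
      rfl
    have : 0 < l ^ s := Real.rpow_pos_of_pos hl s
    rw [h1, h2, hg]
    field_simp
    ring
  -- The rate `p = -(δ - s)/2` is chosen so that `l^s l^{-p} = l^{(δ+s)/2}`; its admissibility `s -
  -- 1 ≤ p` is exactly `δ ≤ 2 - s`.
  have hup : ∀ m : ℕ, g ((m + (Np + 1) : ℕ) : ℤ) ≤
      l ^ ((δ + s) / 2) * Real.exp (-((δ - s) / 2 * k * (m + Np + 1))) := by
    intro m
    rw [hgG]
    refine (mul_le_mul_of_nonneg_left (exp_div_one_add_exp_le (p := -((δ - s) / 2))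
      (by linarith) (by linarith)) (Real.rpow_nonneg hl.le s)).trans (le_of_eq ?_)
    rw [Real.rpow_def_of_pos hl, Real.rpow_def_of_pos hl, ← Real.exp_add, ← Real.exp_add]
    congr 1
    push_cast
    ring
  -- With `p = s` the powers of `l` cancel, hence the plain `L²` norms in the second term of the
  -- final bound.
  have hlo : ∀ m : ℕ, g (-(((m + Nm : ℕ) : ℤ) + 1)) ≤ Real.exp (-(s * k * (m + Nm + 1))) := by
    intro m
    rw [hgG]
    refine (mul_le_mul_of_nonneg_left (exp_div_one_add_exp_le (p := s)
      (by linarith) le_rfl) (Real.rpow_nonneg hl.le s)).trans (le_of_eq ?_)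
    rw [Real.rpow_def_of_pos hl, ← Real.exp_add]
    congr 1
    push_cast
    ring
  obtain ⟨hsu, htu⟩ := summable_exp_and_tsum_le (a := (δ - s) / 2) (by linarith) hk Np
  obtain ⟨hsl, htl⟩ := summable_exp_and_tsum_le hs0 hk Nm
  have hsum_u : Summable fun m : ℕ => g ((m + (Np + 1) : ℕ) : ℤ) :=
    Summable.of_nonneg_of_le (fun _ => hg0 _) hup (hsu.mul_left _)
  have hsum_l : Summable fun m : ℕ => g (-(((m + Nm : ℕ) : ℤ) + 1)) :=
    Summable.of_nonneg_of_le (fun _ => hg0 _) hlo hsl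
  have hsum_u' : Summable fun m : ℕ => g m := (summable_nat_add_iff (Np + 1)).1 hsum_u
  have hsum_l' : Summable fun m : ℕ => g (-((m : ℤ) + 1)) :=
    (summable_nat_add_iff (f := fun m : ℕ => g (-((m : ℤ) + 1))) Nm).1 hsum_l
  have hU := Summable.tsum_le_tsum hup hsum_u (hsu.mul_left _)
  have hL := Summable.tsum_le_tsum hlo hsum_l hsl
  rw [tsum_mul_left] at hU
  have hsplit := tsum_of_nat_of_neg_add_one hsum_u' hsum_l'
  rw [← hsum_u'.sum_add_tsum_nat_add (Np + 1), ← hsum_l'.sum_add_tsum_nat_add Nm] at hsplit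
  have hU0 : 0 ≤ ∑' m : ℕ, g ((m + (Np + 1) : ℕ) : ℤ) := tsum_nonneg fun _ => hg0 _
  have hL0 : 0 ≤ ∑' m : ℕ, g (-(((m + Nm : ℕ) : ℤ) + 1)) := tsum_nonneg fun _ => hg0 _
  have hP := abs_pi_div_sin_sub_tsum_le ⟨hs0, hs1⟩ hk hb (-Real.log l)
  have hls : 0 < l ^ s := Real.rpow_pos_of_pos hl s
  have hT : (∑' j, g j) = l ^ s * ∑' j : ℤ, Real.exp (s * (j * k + -Real.log l)) /
      (1 + Real.exp (j * k + -Real.log l)) := by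
    rw [← tsum_mul_left]; exact tsum_congr hgG
  have hfull : |l ^ s - σ * k * ∑' j, g j| ≤ l ^ s * (c * Q) := by
    rw [hT]
    set S := ∑' j : ℤ, Real.exp (s * (j * k + -Real.log l)) / (1 + Real.exp (j * k + -Real.log l))
    have hσp : σ * (Real.pi / Real.sin (Real.pi * s)) = 1 := by rw [hσe]; field_simp
    calc |l ^ s - σ * k * (l ^ s * S)|
        = |l ^ s * σ * (Real.pi / Real.sin (Real.pi * s) - k * S)| := by
          congr 1; linear_combination (-l ^ s) * hσp
      _ = l ^ s * σ * |Real.pi / Real.sin (Real.pi * s) - k * S| := by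
          rw [abs_mul, abs_of_pos (by positivity)]
      _ ≤ l ^ s * σ * (Real.pi / Real.sin (Real.pi * s) * c * Q) := by gcongr
      _ = _ := by linear_combination (l ^ s * c * Q) * hσp
  -- This distributes the Poisson error `l^s c Q` over the two terms of the bound: the first summand
  -- suffices for `l ≥ 1`, the second for `l ≤ 1`, both coefficients being at least `1`.
  have hlpow : l ^ s ≤ 2 / (δ - s) * l ^ ((δ + s) / 2) + 1 / s := by
    have h1 : 1 ≤ 2 / (δ - s) := by rw [one_le_div (by linarith)]; linarith
    have h2 : 1 ≤ 1 / s := by rw [one_le_div hs0]; linarith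
    have h3 : 0 < l ^ ((δ + s) / 2) := Real.rpow_pos_of_pos hl _
    rcases le_total 1 l with h | h
    · have := Real.rpow_le_rpow_of_exponent_le h (show s ≤ (δ + s) / 2 by linarith)
      nlinarith
    · have := Real.rpow_le_one hl.le h hs0.le
      nlinarith
  have hIcc : ∑ j ∈ Finset.Icc (-(Nm : ℤ)) (Np : ℤ), g j = (∑' j, g j) -
      ∑' m : ℕ, g ((m + (Np + 1) : ℕ) : ℤ) - ∑' m : ℕ, g (-(((m + Nm : ℕ) : ℤ) + 1)) := by
    rw [hsplit, sum_Icc_neg_eq]; ring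
  have hmain : l ^ s - cs s * k / 2 * ∑ j ∈ Finset.Icc (-(Nm : ℤ)) (Np : ℤ), g j =
      (l ^ s - σ * k * ∑' j, g j) + σ * (k * ∑' m : ℕ, g ((m + (Np + 1) : ℕ) : ℤ)) +
        σ * (k * ∑' m : ℕ, g (-(((m + Nm : ℕ) : ℤ) + 1))) := by
    rw [hIcc, hσ]; ring
  have hA : σ * (k * ∑' m : ℕ, g ((m + (Np + 1) : ℕ) : ℤ)) ≤
      c * (l ^ ((δ + s) / 2) * (2 / (δ - s) * Real.exp ((s - δ) * Np * k / 2))) := by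
    have h1 : k * ∑' m : ℕ, g ((m + (Np + 1) : ℕ) : ℤ) ≤
        l ^ ((δ + s) / 2) * (2 / (δ - s) * Real.exp ((s - δ) * Np * k / 2)) := by
      refine (mul_le_mul_of_nonneg_left hU hk.le).trans ?_
      rw [mul_left_comm]
      refine mul_le_mul_of_nonneg_left (htu.trans (le_of_eq ?_)) (Real.rpow_nonneg hl.le _)
      rw [div_div_eq_mul_div, mul_comm (2 / (δ - s)), mul_div_assoc]
      congr 2
      ring
    exact mul_le_mul (hσ1.trans hc1) h1 (by positivity) (by linarith)
  have hB : σ * (k * ∑' m : ℕ, g (-(((m + Nm : ℕ) : ℤ) + 1))) ≤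
      c * (1 / s * Real.exp (-s * Nm * k)) := by
    have h1 : k * ∑' m : ℕ, g (-(((m + Nm : ℕ) : ℤ) + 1)) ≤ 1 / s * Real.exp (-s * Nm * k) := by
      refine (mul_le_mul_of_nonneg_left hL hk.le).trans (htl.trans (le_of_eq ?_))
      rw [div_mul_eq_mul_div, one_mul, neg_mul, neg_mul]
    exact mul_le_mul (hσ1.trans hc1) h1 (by positivity) (by linarith)
  rw [hmain]
  calc _ ≤ |l ^ s - σ * k * ∑' j, g j| + σ * (k * ∑' m : ℕ, g ((m + (Np + 1) : ℕ) : ℤ)) +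
        σ * (k * ∑' m : ℕ, g (-(((m + Nm : ℕ) : ℤ) + 1))) := by
        refine (abs_add_three _ _ _).trans (le_of_eq ?_)
        rw [abs_of_nonneg (by positivity : 0 ≤ σ * (k * ∑' m : ℕ, g ((m + (Np + 1) : ℕ) : ℤ))),
          abs_of_nonneg (by positivity : 0 ≤ σ * (k * ∑' m : ℕ, g (-(((m + Nm : ℕ) : ℤ) + 1))))]
    _ ≤ (2 / (δ - s) * l ^ ((δ + s) / 2) + 1 / s) * (c * Q) +
        c * (l ^ ((δ + s) / 2) * (2 / (δ - s) * Real.exp ((s - δ) * Np * k / 2))) +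
        c * (1 / s * Real.exp (-s * Nm * k)) := by
        refine add_le_add (add_le_add (hfull.trans ?_) hA) hB
        exact mul_le_mul_of_nonneg_right hlpow (by positivity)
    _ = _ := by ring

/-! ### Translations and the Fourier transform on `L²`. -/

/-- Translation by `h` on `L²(ℝ^d)`. -/
noncomputable def translate {d : ℕ} (h : E d) (f : L2 d) : L2 d :=
  Lp.compMeasurePreserving (fun x => x - h) (measurePreserving_sub_right volume h) f

theorem coeFn_translate {d : ℕ} (h : E d) (f : L2 d) :
    (translate h f : E d → ℂ) =ᵐ[volume] fun x => f (x - h) :=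
  Lp.coeFn_compMeasurePreserving f (measurePreserving_sub_right volume h)

theorem continuous_translate {d : ℕ} (h : E d) : Continuous (translate h) :=
  (Lp.isometry_compMeasurePreserving (measurePreserving_sub_right volume h)).continuous

theorem memLp_fourierChar_mul {d : ℕ} (h : E d) (f : L2 d) :
    MemLp (fun ξ => (Real.fourierChar (-inner ℝ h ξ) : ℂ) * f ξ) 2 volume := by
  refine MemLp.of_le (Lp.memLp f) ?_ ?_
  · refine Continuous.aestronglyMeasurable ?_ |>.mul (Lp.aestronglyMeasurable _)
    have := Real.continuous_fourierChar
    fun_prop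
  · exact Filter.Eventually.of_forall fun ξ => by
      rw [norm_mul, Circle.norm_coe, one_mul]

theorem continuous_fourierChar_mul {d : ℕ} (h : E d) :
    Continuous fun f : L2 d => (memLp_fourierChar_mul h f).toLp := by
  refine Isometry.continuous fun f g => ?_
  rw [Lp.edist_toLp_toLp, Lp.edist_def]
  refine eLpNorm_congr_norm_ae (Filter.Eventually.of_forall fun ξ => ?_)
  simp only [Pi.sub_apply]
  rw [← mul_sub, norm_mul, Circle.norm_coe, one_mul]

/-- Both sides are continuous in `f`, so the identity extends from the dense Schwartz functions,
where it is the change of variables in the Fourier integral. -/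
theorem fourier_translate {d : ℕ} (h : E d) (f : L2 d) :
    (𝓕 (translate h f) : L2 d) = (memLp_fourierChar_mul h (𝓕 f : L2 d)).toLp := by
  refine DenseRange.induction_on
    (p := fun f : L2 d => (𝓕 (translate h f) : L2 d) = (memLp_fourierChar_mul h (𝓕 f : L2 d)).toLp)
    (SchwartzMap.denseRange_toLpCLM (E := E d) (F := ℂ) (p := 2) (μ := volume)
      ENNReal.ofNat_ne_top) f ?_ ?_
  · have hF : Continuous fun f : L2 d => (𝓕 f : L2 d) :=
      (Lp.fourierTransformₗᵢ (E d) ℂ).continuous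
    exact isClosed_eq (hF.comp (continuous_translate h)) ((continuous_fourierChar_mul h).comp hF)
  · intro g
    have h1 : translate h (g.toLp 2) = (g.compSubConstCLM ℂ h).toLp 2 := by
      apply Lp.ext
      filter_upwards [coeFn_translate h (g.toLp 2), (g.compSubConstCLM ℂ h).coeFn_toLp 2,
        (measurePreserving_sub_right volume h).quasiMeasurePreserving.ae_eq_comp
          (g.coeFn_toLp 2)]
        with x h1 h2 h3
      rw [h1, h2, SchwartzMap.compSubConstCLM_apply]
      exact h3
    rw [SchwartzMap.toLpCLM_apply, h1, SchwartzMap.toLp_fourier_eq]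
    apply Lp.ext
    filter_upwards [(𝓕 (g.compSubConstCLM ℂ h)).coeFn_toLp 2,
      (memLp_fourierChar_mul h (𝓕 (g.toLp 2) : L2 d)).coeFn_toLp, (𝓕 g).coeFn_toLp 2] with ξ h1 h2 h3
    rw [h1, h2, SchwartzMap.toLp_fourier_eq, h3, SchwartzMap.fourier_coe, SchwartzMap.fourier_coe]
    have := congrFun (VectorFourier.fourierIntegral_comp_add_right Real.fourierChar
      (volume : Measure (E d)) (innerₗ (E d)) g (-h)) ξ
    simp only [innerₗ_apply_apply, inner_neg_left] at this
    exact this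

theorem lintegral_enorm_sq_eq {d : ℕ} (f : L2 d) : ∫⁻ x, ‖f x‖ₑ ^ 2 = ‖f‖ₑ ^ 2 := by
  rw [Lp.enorm_def, eLpNorm_eq_lintegral_rpow_enorm_toReal (by simp) (by simp)]
  rw [← ENNReal.rpow_natCast, ← ENNReal.rpow_mul]
  simp

theorem enorm_sq_fourierChar_sub_one (t : ℝ) (z : ℂ) :
    ‖(Real.fourierChar (-t) : ℂ) * z - z‖ₑ ^ 2 =
      ENNReal.ofReal (2 * (1 - Real.cos (2 * Real.pi * t))) * ‖z‖ₑ ^ 2 := by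
  have h : ‖(Real.fourierChar (-t) : ℂ) - 1‖ ^ 2 = 2 * (1 - Real.cos (2 * Real.pi * t)) := by
    rw [Real.fourierChar_apply, mul_neg, Complex.ofReal_neg, ← Complex.normSq_eq_norm_sq,
      Complex.normSq_apply, ← Complex.ofReal_neg]
    simp only [Complex.sub_re, Complex.sub_im, Complex.exp_ofReal_mul_I_re,
      Complex.exp_ofReal_mul_I_im, Complex.one_re, Complex.one_im, Real.cos_neg, Real.sin_neg]
    nlinarith [Real.sin_sq_add_cos_sq (2 * Real.pi * t)]
  rw [← sub_one_mul, enorm_mul, mul_pow, ← h, ENNReal.ofReal_pow (norm_nonneg _), ofReal_norm]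

theorem lintegral_enorm_translate_sub {d : ℕ} (h : E d) (f : L2 d) :
    ∫⁻ x, ‖f (x - h) - f x‖ₑ ^ 2 =
      ∫⁻ ξ, ENNReal.ofReal (2 * (1 - Real.cos (2 * Real.pi * inner ℝ h ξ))) *
        ‖(𝓕 f : L2 d) ξ‖ₑ ^ 2 := by
  have h1 : ∫⁻ x, ‖f (x - h) - f x‖ₑ ^ 2 = ∫⁻ x, ‖(translate h f - f : L2 d) x‖ₑ ^ 2 := by
    refine lintegral_congr_ae ?_
    filter_upwards [coeFn_translate h f, Lp.coeFn_sub (translate h f) f] with x h1 h2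
    rw [h2, Pi.sub_apply, h1]
  have h2 : (𝓕 (translate h f - f) : L2 d) = 𝓕 (translate h f) - 𝓕 f :=
    map_sub (Lp.fourierTransformₗᵢ (E d) ℂ) _ _
  rw [h1, lintegral_enorm_sq_eq, enorm_eq_iff_norm_eq.2 (Lp.norm_fourier_eq _).symm,
    ← lintegral_enorm_sq_eq, h2, fourier_translate]
  refine lintegral_congr_ae ?_
  filter_upwards [Lp.coeFn_sub (memLp_fourierChar_mul h (𝓕 f : L2 d)).toLp (𝓕 f : L2 d),
    (memLp_fourierChar_mul h (𝓕 f : L2 d)).coeFn_toLp] with ξ h1 h2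
  rw [h1, Pi.sub_apply, h2, enorm_sq_fourierChar_sub_one]

/-! ### The double-integral norm on the Fourier side. -/

/-- The numerator is at most a multiple of `min (‖h‖²) 1`. In polar coordinates this leaves
`y^{1-2r}` near `0` and `y^{-1-2r}` at infinity, integrable for `r < 1` and `r > 0` respectively. -/
theorem integrable_one_sub_cos_div {d : ℕ} [NeZero d] {r : ℝ} (hr : r ∈ Ioo (0 : ℝ) 1) (ζ : E d) :
    Integrable fun h : E d => (1 - Real.cos (inner ℝ ζ h)) / ‖h‖ ^ ((d : ℝ) + 2 * r) := by
  have hd : 1 ≤ d := NeZero.one_le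
  have : Nontrivial (E d) := Module.nontrivial_of_finrank_pos (R := ℝ) (by rw [finrank_euclideanSpace_fin]; lia)
  set φ : ℝ → ℝ := fun y => min (y ^ 2) 1 / y ^ ((d : ℝ) + 2 * r) with hφ
  have hint : Integrable fun h : E d => φ ‖h‖ := by
    rw [integrable_fun_norm_addHaar (volume : Measure (E d))]
    have heq : ∀ y : ℝ, 0 < y → y ^ (Module.finrank ℝ (E d) - 1) • φ y =
        min (y ^ 2) 1 * y ^ (-1 - 2 * r) := by
      intro y hy
      rw [hφ, finrank_euclideanSpace_fin, smul_eq_mul, ← Real.rpow_natCast, Nat.cast_sub hd,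
        mul_div_left_comm, ← Real.rpow_sub hy]
      congr 2
      push_cast
      ring
    rw [← Ioc_union_Ioi_eq_Ioi zero_le_one]
    refine IntegrableOn.union ?_ ?_
    · have h1 : IntegrableOn (fun y : ℝ => y ^ (1 - 2 * r)) (Ioc 0 1) :=
        (intervalIntegrable_iff_integrableOn_Ioc_of_le zero_le_one).1
          (intervalIntegral.intervalIntegrable_rpow' (by linarith [hr.2]))
      refine h1.congr_fun (fun y hy => ?_) measurableSet_Ioc
      simp only
      rw [heq y hy.1, min_eq_left (pow_le_one₀ hy.1.le hy.2), ← Real.rpow_two, ← Real.rpow_add hy.1]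
      congr 1; ring
    · have h1 : IntegrableOn (fun y : ℝ => y ^ (-1 - 2 * r)) (Ioi 1) :=
        integrableOn_Ioi_rpow_of_lt (by linarith [hr.1]) one_pos
      refine h1.congr_fun (fun y hy => ?_) measurableSet_Ioi
      simp only
      rw [heq y (one_pos.trans hy), min_eq_right (one_le_pow₀ (le_of_lt hy)), one_mul]
  refine (hint.const_mul (‖ζ‖ ^ 2 / 2 + 2)).mono' ?_ ?_
  · refine Measurable.aestronglyMeasurable ?_
    fun_prop
  · refine Filter.Eventually.of_forall fun h => ?_
    have h0 : 0 ≤ 1 - Real.cos (inner ℝ ζ h) := by linarith [Real.cos_le_one (inner ℝ ζ h)]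
    rw [Real.norm_of_nonneg (by positivity), hφ, ← mul_div_assoc]
    refine div_le_div_of_nonneg_right ?_ (by positivity)
    have h1 : 1 - Real.cos (inner ℝ ζ h) ≤ ‖ζ‖ ^ 2 / 2 * ‖h‖ ^ 2 := by
      have := Real.one_sub_sq_div_two_le_cos (x := inner ℝ ζ h)
      have h2 : (inner ℝ ζ h) ^ 2 ≤ (‖ζ‖ * ‖h‖) ^ 2 :=
        sq_le_sq.2 ((abs_real_inner_le_norm ζ h).trans (le_abs_self _))
      nlinarith
    have h2 : 1 - Real.cos (inner ℝ ζ h) ≤ 2 := by linarith [Real.neg_one_le_cos (inner ℝ ζ h)]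
    rcases le_total (‖h‖ ^ 2) 1 with h3 | h3
    · rw [min_eq_left h3]; nlinarith [sq_nonneg ‖h‖]
    · rw [min_eq_right h3]; nlinarith [sq_nonneg ‖ζ‖]

theorem inner_single_zero {d : ℕ} [NeZero d] (h : E d) :
    inner ℝ (EuclideanSpace.single (0 : Fin d) (1 : ℝ)) h = h 0 := by
  simp [EuclideanSpace.inner_single_left]

theorem cdr_pos {d : ℕ} [NeZero d] {r : ℝ} (hr : r ∈ Ioo (0 : ℝ) 1) : 0 < cdr d r := by
  have hint := integrable_one_sub_cos_div hr (EuclideanSpace.single (0 : Fin d) (1 : ℝ))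
  simp only [inner_single_zero] at hint
  rw [cdr, inv_pos, integral_pos_iff_support_of_nonneg _ hint]
  · have hopen : IsOpen {h : E d | Real.cos (h 0) ≠ 1} :=
      isOpen_ne_fun (by fun_prop) continuous_const
    refine (hopen.measure_pos volume ⟨EuclideanSpace.single 0 Real.pi, ?_⟩).trans_le
      (measure_mono fun h hh => ?_)
    · simp; norm_num
    · have hh' : Real.cos (h 0) ≠ 1 := hh
      have h0 : h ≠ 0 := by rintro rfl; simp at hh'
      have : 0 < ‖h‖ := norm_pos_iff.2 h0
      exact div_ne_zero (sub_ne_zero.2 hh'.symm) (by positivity)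
  · intro h
    have : 0 ≤ 1 - Real.cos (h 0) := by linarith [Real.cos_le_one (h 0)]
    simp only [Pi.zero_apply]
    positivity

/-- By rotation invariance `ζ` may be moved onto the first axis, and scaling `h` by `‖ζ‖` then
extracts `‖ζ‖^{d+2r} ‖ζ‖^{-d}`. -/
theorem integral_one_sub_cos_div {d : ℕ} [NeZero d] {r : ℝ} (hr : r ∈ Ioo (0 : ℝ) 1) (ζ : E d) :
    ∫ h : E d, (1 - Real.cos (inner ℝ ζ h)) / ‖h‖ ^ ((d : ℝ) + 2 * r) =
      ‖ζ‖ ^ (2 * r) * (cdr d r)⁻¹ := by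
  rcases eq_or_ne ζ 0 with rfl | hζ
  · simp [Real.zero_rpow (show 2 * r ≠ 0 by linarith [hr.1])]
  have hn : 0 < ‖ζ‖ := norm_pos_iff.2 hζ
  set e : E d := EuclideanSpace.single 0 1 with he
  -- The Householder reflection that exchanges the equally long vectors `ζ` and `‖ζ‖ e`.
  set R : E d ≃ₗᵢ[ℝ] E d := Submodule.reflection (ℝ ∙ (ζ - ‖ζ‖ • e))ᗮ with hR
  have hRζ : R ζ = ‖ζ‖ • e := Submodule.reflection_sub (by simp [norm_smul, he])
  have hin : ∀ h : E d, (R (‖ζ‖ • h)) 0 = inner ℝ ζ h := by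
    intro h
    rw [← R.inner_map_map, hRζ, inner_smul_left, he, inner_single_zero, map_smul]
    simp
  set F : E d → ℝ := fun h => (1 - Real.cos (h 0)) / ‖h‖ ^ ((d : ℝ) + 2 * r) with hF
  have h1 : (fun h : E d => (1 - Real.cos (inner ℝ ζ h)) / ‖h‖ ^ ((d : ℝ) + 2 * r)) =
      fun h => ‖ζ‖ ^ ((d : ℝ) + 2 * r) * F (R (‖ζ‖ • h)) := by
    ext h
    have := Real.rpow_pos_of_pos hn ((d : ℝ) + 2 * r)
    rw [hF]
    simp only [hin]
    rw [LinearIsometryEquiv.norm_map, norm_smul, norm_norm, Real.mul_rpow hn.le (norm_nonneg _)]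
    field_simp
  rw [h1, integral_const_mul, Measure.integral_comp_smul volume (fun h => F (R h)),
    R.measurePreserving.integral_comp R.toHomeomorph.measurableEmbedding, cdr, inv_inv,
    finrank_euclideanSpace_fin, abs_of_pos (by positivity), smul_eq_mul, Real.rpow_add hn,
    Real.rpow_natCast]
  have : ‖ζ‖ ^ d ≠ 0 := by positivity
  field_simp
  rfl

theorem measurable_zeroExtFun {d : ℕ} (D : TopologicalSpace.Opens (E d)) (η : L2D D) :
    Measurable (zeroExtFun D η) :=
  (Lp.stronglyMeasurable η).measurable.indicator D.isOpen.measurableSet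

theorem coeFn_zeroExt {d : ℕ} (D : TopologicalSpace.Opens (E d)) (η : L2D D) :
    (zeroExt D η : E d → ℂ) =ᵐ[volume] fun x => (zeroExtFun D η x : ℂ) :=
  (memLp_zeroExtFun D η).coeFn_toLp

theorem lintegral_one_sub_cos_div {d : ℕ} [NeZero d] {r : ℝ} (hr : r ∈ Ioo (0 : ℝ) 1) (ξ : E d) :
    ∫⁻ h : E d, ENNReal.ofReal (‖h‖ ^ ((d : ℝ) + 2 * r))⁻¹ *
        ENNReal.ofReal (2 * (1 - Real.cos (2 * Real.pi * inner ℝ h ξ))) =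
      ENNReal.ofReal (2 * (cdr d r)⁻¹) * ENNReal.ofReal (lapSymbol r ξ) := by
  have hi := integrable_one_sub_cos_div hr ((2 * Real.pi) • ξ)
  have hv := integral_one_sub_cos_div hr ((2 * Real.pi) • ξ)
  have h0 : ∀ h : E d, 0 ≤ 1 - Real.cos (inner ℝ ((2 * Real.pi) • ξ) h) := fun h => by
    linarith [Real.cos_le_one (inner ℝ ((2 * Real.pi) • ξ) h)]
  have heq : ∀ h : E d, ENNReal.ofReal (‖h‖ ^ ((d : ℝ) + 2 * r))⁻¹ *
        ENNReal.ofReal (2 * (1 - Real.cos (2 * Real.pi * inner ℝ h ξ))) =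
      ENNReal.ofReal (2 * ((1 - Real.cos (inner ℝ ((2 * Real.pi) • ξ) h)) /
        ‖h‖ ^ ((d : ℝ) + 2 * r))) := by
    intro h
    rw [← ENNReal.ofReal_mul (by positivity), inner_smul_left, real_inner_comm]
    congr 1
    simp
    ring
  simp_rw [heq]
  rw [← ofReal_integral_eq_lintegral_ofReal (hi.const_mul 2)
    (Filter.Eventually.of_forall fun h => by have := h0 h; simp only [Pi.zero_apply]; positivity),
    integral_const_mul, hv, ← ENNReal.ofReal_mul (by have := cdr_pos (d := d) hr; positivity),
    lapSymbol, norm_smul, Real.norm_of_nonneg (by positivity : 0 ≤ 2 * Real.pi)]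
  congr 1
  ring

/-- Substituting `y = x - h` and applying Tonelli, the inner integral is the squared `L²` norm of a
translation difference. Plancherel and a second use of Tonelli leave the integral in `h` that
defines `cdr`. Extended nonnegative integrals make finiteness hypotheses unnecessary. -/
theorem gagliardoSq_eq {d : ℕ} [NeZero d] (D : TopologicalSpace.Opens (E d)) {r : ℝ}
    (hr : r ∈ Ioo (0 : ℝ) 1) (η : L2D D) :
    gagliardoSq D r η = ENNReal.ofReal (2 * (cdr d r)⁻¹) *
      ∫⁻ ξ, ENNReal.ofReal (lapSymbol r ξ) * ‖(𝓕 (zeroExt D η) : L2 d) ξ‖ₑ ^ 2 := by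
  set z := zeroExtFun D η with hz
  have hzm : Measurable z := measurable_zeroExtFun D η
  set f := zeroExt D η with hf
  have hFm : Measurable (fun ξ => ‖(𝓕 f : L2 d) ξ‖ₑ ^ 2) :=
    ((Lp.stronglyMeasurable (𝓕 f : L2 d)).measurable.enorm.pow_const 2)
  calc gagliardoSq D r η
      = ∫⁻ x : E d, ∫⁻ h : E d, ENNReal.ofReal
          ((z x - z (x - h)) ^ 2 / ‖h‖ ^ ((d : ℝ) + 2 * r)) := by
        refine lintegral_congr fun x => ?_
        rw [← lintegral_sub_left_eq_self _ x]
        simp only [sub_sub_cancel]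
        rfl
    _ = ∫⁻ h : E d, ∫⁻ x : E d, ENNReal.ofReal
          ((z x - z (x - h)) ^ 2 / ‖h‖ ^ ((d : ℝ) + 2 * r)) := by
        refine lintegral_lintegral_swap (Measurable.aemeasurable ?_)
        unfold Function.uncurry
        fun_prop
    _ = ∫⁻ h : E d, ENNReal.ofReal (‖h‖ ^ ((d : ℝ) + 2 * r))⁻¹ *
          ∫⁻ x : E d, ‖f (x - h) - f x‖ₑ ^ 2 := by
        refine lintegral_congr fun h => ?_
        rw [← lintegral_const_mul' _ _ ENNReal.ofReal_ne_top]
        refine lintegral_congr_ae ?_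
        filter_upwards [coeFn_zeroExt D η, (measurePreserving_sub_right volume
          h).quasiMeasurePreserving.ae (coeFn_zeroExt D η)] with x h1 h2
        rw [hf, h1, h2, ← Complex.ofReal_sub, ← ofReal_norm, Complex.norm_real, Real.norm_eq_abs,
          ← ENNReal.ofReal_pow (abs_nonneg _), sq_abs, ← ENNReal.ofReal_mul (by positivity)]
        congr 1
        rw [hz]
        ring
    _ = ∫⁻ h : E d, ∫⁻ ξ : E d, ENNReal.ofReal (‖h‖ ^ ((d : ℝ) + 2 * r))⁻¹ *
          ENNReal.ofReal (2 * (1 - Real.cos (2 * Real.pi * inner ℝ h ξ))) *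
            ‖(𝓕 f : L2 d) ξ‖ₑ ^ 2 := by
        refine lintegral_congr fun h => ?_
        rw [lintegral_enorm_translate_sub, ← lintegral_const_mul' _ _ ENNReal.ofReal_ne_top]
        simp only [mul_assoc]
    _ = ∫⁻ ξ : E d, ∫⁻ h : E d, ENNReal.ofReal (‖h‖ ^ ((d : ℝ) + 2 * r))⁻¹ *
          ENNReal.ofReal (2 * (1 - Real.cos (2 * Real.pi * inner ℝ h ξ))) *
            ‖(𝓕 f : L2 d) ξ‖ₑ ^ 2 := by
        refine lintegral_lintegral_swap (Measurable.aemeasurable ?_)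
        unfold Function.uncurry
        fun_prop
    _ = ∫⁻ ξ : E d, ENNReal.ofReal (2 * (cdr d r)⁻¹) * (ENNReal.ofReal (lapSymbol r ξ) *
          ‖(𝓕 f : L2 d) ξ‖ₑ ^ 2) := by
        refine lintegral_congr fun ξ => ?_
        rw [lintegral_mul_const _ (by fun_prop), lintegral_one_sub_cos_div hr, mul_assoc]
    _ = _ := by rw [lintegral_const_mul' _ _ ENNReal.ofReal_ne_top]

/-! ### The symbol of the fractional Laplacian and weighted `L²` bounds. -/

theorem lapSymbol_nonneg {d : ℕ} (α : ℝ) (ξ : E d) : 0 ≤ lapSymbol α ξ := by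
  unfold lapSymbol; positivity

theorem lapSymbol_mul_self {d : ℕ} {α : ℝ} (hα : 0 < α) (ξ : E d) :
    lapSymbol (α / 2) ξ * lapSymbol (α / 2) ξ = lapSymbol α ξ := by
  unfold lapSymbol
  rw [← Real.rpow_add_of_nonneg (by positivity) (by linarith) (by linarith)]
  congr 1; ring

theorem lapSymbol_eq_rpow {d : ℕ} (α : ℝ) (ξ : E d) : lapSymbol α ξ = lapSymbol 1 ξ ^ α := by
  unfold lapSymbol
  rw [← Real.rpow_mul (by positivity), mul_one]

theorem measurable_lapSymbol {d : ℕ} (α : ℝ) : Measurable (lapSymbol α : E d → ℝ) := by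
  unfold lapSymbol; fun_prop

theorem norm_zeroExt {d : ℕ} (D : TopologicalSpace.Opens (E d)) (η : L2D D) :
    ‖zeroExt D η‖ = ‖η‖ := by
  rw [zeroExt, Lp.norm_toLp, Lp.norm_def, ← eLpNorm_indicator_eq_eLpNorm_restrict
    D.isOpen.measurableSet]
  congr 1
  exact eLpNorm_congr_norm_ae (Filter.Eventually.of_forall fun x => Complex.norm_real _)

theorem lintegral_lapSymbol_le_sobolevNormSq {d : ℕ} {α r : ℝ} (hα : 0 ≤ α) (hr : α ≤ r)
    (f : L2 d) :
    ∫⁻ ξ, ENNReal.ofReal (lapSymbol α ξ) * ‖(𝓕 f : L2 d) ξ‖ₑ ^ 2 ≤ sobolevNormSq r f := by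
  refine lintegral_mono fun ξ => ?_
  refine mul_le_mul_left (ENNReal.ofReal_le_ofReal ?_) _
  rw [lapSymbol, Real.rpow_mul (by positivity), Real.rpow_two]
  calc ((2 * Real.pi * ‖ξ‖) ^ 2) ^ α ≤ (1 + (2 * Real.pi * ‖ξ‖) ^ 2) ^ α :=
        Real.rpow_le_rpow (by positivity) (by linarith) hα
    _ ≤ _ := Real.rpow_le_rpow_of_exponent_le (by nlinarith [sq_nonneg (2 * Real.pi * ‖ξ‖)]) hr

theorem normHTilde_nonneg {d : ℕ} [NeZero d] (D : TopologicalSpace.Opens (E d)) (r : ℝ)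
    (η : L2D D) : 0 ≤ normHTilde D r η := by
  unfold normHTilde; split_ifs <;> positivity

/-- For `r < 1` the factor `cdr d r / 2` is exactly what makes this an equality; for `r ≥ 1` it is
the pointwise bound `|ζ|^{2r} ≤ (1 + |ζ|²)^r`. Membership in `H̃^r(D)` keeps `toReal` from turning
an infinite integral into `0`. -/
theorem lintegral_lapSymbol_le_normHTilde {d : ℕ} [NeZero d] (D : TopologicalSpace.Opens (E d))
    {r : ℝ} (hr : 0 < r) {η : L2D D} (hη : MemHTilde D r η) :
    ∫⁻ ξ, ENNReal.ofReal (lapSymbol r ξ) * ‖(𝓕 (zeroExt D η) : L2 d) ξ‖ₑ ^ 2 ≤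
      ENNReal.ofReal (normHTilde D r η ^ 2) := by
  have hle := lintegral_lapSymbol_le_sobolevNormSq hr.le le_rfl (zeroExt D η)
  have hfin := ne_top_of_le_ne_top (ne_of_lt hη) hle
  unfold normHTilde
  split_ifs with h
  · have hc := cdr_pos (d := d) ⟨hr, h⟩
    rw [Real.sq_sqrt (by positivity), gagliardoSq_eq D ⟨hr, h⟩, ENNReal.toReal_mul,
      ENNReal.toReal_ofReal (by positivity), ← mul_assoc,
      show cdr d r / 2 * (2 * (cdr d r)⁻¹) = 1 by field_simp, one_mul, ENNReal.ofReal_toReal hfin]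
  · rw [Real.sq_sqrt ENNReal.toReal_nonneg, ENNReal.ofReal_toReal (ne_of_lt hη)]
    exact hle

theorem mem_fracLapDomain_of_lintegral_lt_top {d : ℕ} {α : ℝ} (hα : 0 < α) {f : L2 d}
    (hf : ∫⁻ ξ, ENNReal.ofReal (lapSymbol α ξ) * ‖(𝓕 f : L2 d) ξ‖ₑ ^ 2 < ⊤) :
    f ∈ fracLapDomain (α / 2) := by
  refine ⟨(Complex.measurable_ofReal.comp (measurable_lapSymbol _)).aestronglyMeasurable.mul
    (Lp.aestronglyMeasurable _), ?_⟩
  rw [eLpNorm_lt_top_iff_lintegral_rpow_enorm_lt_top (by simp) (by simp)]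
  refine lt_of_eq_of_lt (lintegral_congr fun ξ => ?_) hf
  rw [ENNReal.toReal_ofNat, ENNReal.rpow_two, enorm_mul, mul_pow, ← ofReal_norm (lapSymbol _ _ : ℂ),
    Complex.norm_real, Real.norm_of_nonneg (lapSymbol_nonneg _ _),
    ← ENNReal.ofReal_pow (lapSymbol_nonneg _ _), sq, lapSymbol_mul_self hα]

theorem lintegral_mul_le_of_sq_le {α : Type*} [MeasurableSpace α] {μ : Measure α}
    {u v : α → ℝ≥0∞} (hu : AEMeasurable u μ) (hv : AEMeasurable v μ) {M N : ℝ}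
    (hM : 0 ≤ M) (hN : 0 ≤ N) (huM : ∫⁻ x, u x ^ 2 ∂μ ≤ ENNReal.ofReal (M ^ 2))
    (hvN : ∫⁻ x, v x ^ 2 ∂μ ≤ ENNReal.ofReal (N ^ 2)) :
    ∫⁻ x, u x * v x ∂μ ≤ ENNReal.ofReal (M * N) := by
  have key : ∀ {w : α → ℝ≥0∞} {K : ℝ}, 0 ≤ K → ∫⁻ x, w x ^ 2 ∂μ ≤ ENNReal.ofReal (K ^ 2) →
      (∫⁻ x, w x ^ (2 : ℝ) ∂μ) ^ (1 / (2 : ℝ)) ≤ ENNReal.ofReal K := by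
    intro w K hK h
    simp only [ENNReal.rpow_two]
    refine (ENNReal.rpow_le_rpow h (by norm_num)).trans (le_of_eq ?_)
    rw [ENNReal.ofReal_pow hK, ← ENNReal.rpow_two, ← ENNReal.rpow_mul]
    norm_num
  refine (ENNReal.lintegral_mul_le_Lp_mul_Lq μ Real.HolderConjugate.two_two hu hv).trans ?_
  rw [ENNReal.ofReal_mul hM]
  exact mul_le_mul' (key hM huM) (key hN hvN)

/-! ### The two bilinear forms as integrals of symbols. -/

theorem inner_eq_integral_fourier {d : ℕ} (f g : L2 d) :
    (inner ℂ f g : ℂ) = ∫ ξ, (𝓕 g : L2 d) ξ * (starRingEnd ℂ) ((𝓕 f : L2 d) ξ) := by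
  rw [← Lp.inner_fourier_eq, L2.inner_def]
  rfl

theorem integrable_fourier_mul_conj {d : ℕ} (f g : L2 d) :
    Integrable fun ξ => (𝓕 g : L2 d) ξ * (starRingEnd ℂ) ((𝓕 f : L2 d) ξ) :=
  L2.integrable_inner (𝕜 := ℂ) (𝓕 f : L2 d) (𝓕 g : L2 d)

/-- No formula for the resolvent is needed: with `u` the preimage of `ψ`, both `𝓕 ψ` and `𝓕 w` are
explicit multiples of `𝓕 u`. -/
theorem fourier_w {d : ℕ} (ψ : L2 d) {t : ℝ} (ht : 0 < t) :
    ((𝓕 (w ψ t) : L2 d) : E d → ℂ) =ᵐ[volume] fun ξ =>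
      ((t ^ 2 * lapSymbol 1 ξ / (1 + t ^ 2 * lapSymbol 1 ξ) : ℝ) : ℂ) * (𝓕 ψ : L2 d) ξ := by
  have hb := bijOn_resolvent (d := d) (τ := t ^ 2) (by positivity)
  have hex := hb.surjOn (mem_univ ψ)
  have hu : resolvent (t ^ 2) ψ ∈ fracLapDomain 1 := Function.invFunOn_mem hex
  have hue : resolvent (t ^ 2) ψ + ((t ^ 2 : ℝ) : ℂ) • fracLap 1 (resolvent (t ^ 2) ψ) = ψ :=
    Function.invFunOn_eq hex
  rw [w]
  set u := resolvent (t ^ 2) ψ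
  have hψ : (𝓕 ψ : L2 d) = 𝓕 u + ((t ^ 2 : ℝ) : ℂ) • 𝓕 (fracLap 1 u) := by
    conv_lhs => rw [← hue]
    rw [FourierTransform.fourier_add, FourierTransform.fourier_smul]
  rw [hψ, FourierTransform.fourier_smul]
  filter_upwards [fourier_fracLap hu, Lp.coeFn_add (𝓕 u : L2 d) (((t ^ 2 : ℝ) : ℂ) • 𝓕 (fracLap 1 u)),
      Lp.coeFn_smul ((t ^ 2 : ℝ) : ℂ) (𝓕 (fracLap 1 u) : L2 d)] with ξ h1 h2 h3
  rw [h2, Pi.add_apply, h3, Pi.smul_apply, h1, smul_eq_mul]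
  have h0 := lapSymbol_nonneg 1 ξ
  have hne : ((1 + t ^ 2 * lapSymbol 1 ξ : ℝ) : ℂ) ≠ 0 := by
    exact_mod_cast (by positivity : (0 : ℝ) < 1 + t ^ 2 * lapSymbol 1 ξ).ne'
  rw [Complex.ofReal_div, div_mul_eq_mul_div, eq_div_iff hne]
  push_cast
  ring

theorem setIntegral_mul_eq_inner {d : ℕ} (D : TopologicalSpace.Opens (E d)) (θ : L2D D)
    (g : L2 d) :
    ∫ x in (D : Set (E d)), g x * (θ x : ℂ) = (inner ℂ (zeroExt D θ) g : ℂ) := by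
  rw [L2.inner_def, ← integral_indicator D.isOpen.measurableSet]
  refine integral_congr_ae ?_
  filter_upwards [coeFn_zeroExt D θ] with x hx
  rw [hx, RCLike.inner_apply, Complex.conj_ofReal, zeroExtFun]
  by_cases h : x ∈ (D : Set (E d)) <;> simp [h]

theorem a_eq_integral {d : ℕ} (D : TopologicalSpace.Opens (E d)) {s : ℝ} (hs : 0 < s)
    {η θ : L2D D} (hη : zeroExt D η ∈ fracLapDomain (s / 2))
    (hθ : zeroExt D θ ∈ fracLapDomain (s / 2)) :
    (Integrable fun ξ => ((lapSymbol 1 ξ ^ s : ℝ) : ℂ) * ((𝓕 (zeroExt D η) : L2 d) ξ *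
      (starRingEnd ℂ) ((𝓕 (zeroExt D θ) : L2 d) ξ))) ∧
    a D s η θ = ∫ ξ, ((lapSymbol 1 ξ ^ s : ℝ) : ℂ) * ((𝓕 (zeroExt D η) : L2 d) ξ *
      (starRingEnd ℂ) ((𝓕 (zeroExt D θ) : L2 d) ξ)) := by
  have hae : (fun ξ => (𝓕 (fracLap (s / 2) (zeroExt D η)) : L2 d) ξ *
      (starRingEnd ℂ) ((𝓕 (fracLap (s / 2) (zeroExt D θ)) : L2 d) ξ)) =ᵐ[volume]
      fun ξ => ((lapSymbol 1 ξ ^ s : ℝ) : ℂ) * ((𝓕 (zeroExt D η) : L2 d) ξ *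
      (starRingEnd ℂ) ((𝓕 (zeroExt D θ) : L2 d) ξ)) := by
    filter_upwards [fourier_fracLap hη, fourier_fracLap hθ] with ξ h1 h2
    rw [h1, h2, ← lapSymbol_eq_rpow, ← lapSymbol_mul_self hs, map_mul, Complex.conj_ofReal]
    push_cast
    ring
  refine ⟨(integrable_fourier_mul_conj _ _).congr hae, ?_⟩
  rw [a, inner_eq_integral_fourier]
  exact integral_congr_ae hae

theorem ak_eq_integral {d : ℕ} (D : TopologicalSpace.Opens (E d)) (s k : ℝ) (Nm Np : ℕ)
    (η θ : L2D D) :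
    (Integrable fun ξ => ((cs s * k / 2 * ∑ j ∈ Finset.Icc (-(Nm : ℤ)) (Np : ℤ),
        Real.exp (s * (j * k)) * (lapSymbol 1 ξ / (Real.exp (j * k) + lapSymbol 1 ξ)) : ℝ) : ℂ) *
        ((𝓕 (zeroExt D η) : L2 d) ξ * (starRingEnd ℂ) ((𝓕 (zeroExt D θ) : L2 d) ξ))) ∧
    ak D s k Nm Np η θ = ∫ ξ, ((cs s * k / 2 * ∑ j ∈ Finset.Icc (-(Nm : ℤ)) (Np : ℤ),
        Real.exp (s * (j * k)) * (lapSymbol 1 ξ / (Real.exp (j * k) + lapSymbol 1 ξ)) : ℝ) : ℂ) *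
        ((𝓕 (zeroExt D η) : L2 d) ξ * (starRingEnd ℂ) ((𝓕 (zeroExt D θ) : L2 d) ξ)) := by
  have hterm : ∀ j : ℤ, (fun ξ => (𝓕 (w (zeroExt D η) (Real.exp (-(j * k) / 2))) : L2 d) ξ *
      (starRingEnd ℂ) ((𝓕 (zeroExt D θ) : L2 d) ξ)) =ᵐ[volume] fun ξ =>
      ((lapSymbol 1 ξ / (Real.exp (j * k) + lapSymbol 1 ξ) : ℝ) : ℂ) *
        ((𝓕 (zeroExt D η) : L2 d) ξ * (starRingEnd ℂ) ((𝓕 (zeroExt D θ) : L2 d) ξ)) := by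
    intro j
    filter_upwards [fourier_w (zeroExt D η) (Real.exp_pos (-(j * k) / 2))] with ξ h
    have h0 := lapSymbol_nonneg 1 ξ
    -- The nodes `t_j` satisfy `t_j² = e^{-y_j}`, which turns the symbol of `w` into `l / (e^{y_j} +
    -- l)`.
    have ht : Real.exp (-(j * k) / 2) ^ 2 = (Real.exp (j * k))⁻¹ := by
      rw [← Real.exp_nat_mul, ← Real.exp_neg]; congr 1; push_cast; ring
    have hE := Real.exp_pos (j * k)
    rw [h, ht, mul_assoc]
    congr 2
    field_simp
  have hint := fun j : ℤ => ((integrable_fourier_mul_conj (zeroExt D θ)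
    (w (zeroExt D η) (Real.exp (-(j * k) / 2)))).congr (hterm j)).const_mul
      ((Real.exp (s * (j * k)) : ℝ) : ℂ)
  have hfun : (fun ξ => ((cs s * k / 2 * ∑ j ∈ Finset.Icc (-(Nm : ℤ)) (Np : ℤ),
        Real.exp (s * (j * k)) * (lapSymbol 1 ξ / (Real.exp (j * k) + lapSymbol 1 ξ)) : ℝ) : ℂ) *
        ((𝓕 (zeroExt D η) : L2 d) ξ * (starRingEnd ℂ) ((𝓕 (zeroExt D θ) : L2 d) ξ))) =
      fun ξ => ((cs s * k / 2 : ℝ) : ℂ) * ∑ j ∈ Finset.Icc (-(Nm : ℤ)) (Np : ℤ),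
        ((Real.exp (s * (j * k)) : ℝ) : ℂ) *
        (((lapSymbol 1 ξ / (Real.exp (j * k) + lapSymbol 1 ξ) : ℝ) : ℂ) *
        ((𝓕 (zeroExt D η) : L2 d) ξ * (starRingEnd ℂ) ((𝓕 (zeroExt D θ) : L2 d) ξ))) := by
    ext ξ
    rw [Complex.ofReal_mul, Complex.ofReal_sum, mul_assoc, Finset.sum_mul]
    simp only [Complex.ofReal_mul, mul_assoc]
  rw [hfun]
  refine ⟨(integrable_finsetSum _ fun j _ => hint j).const_mul _, ?_⟩
  rw [integral_const_mul, integral_finsetSum _ fun j _ => hint j, ak]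
  congr 1
  refine Finset.sum_congr rfl fun j _ => ?_
  rw [integral_const_mul, setIntegral_mul_eq_inner, inner_eq_integral_fourier,
    integral_congr_ae (hterm j)]

/-- The weight `l^{(δ+s)/2}` splits as `l^{δ/2} l^{s/2}`, one factor for each function, so
Cauchy-Schwarz meets precisely the `H̃^δ` and `H̃^s` norms; the constant part uses Plancherel alone.
-/
theorem norm_integral_symbol_le {d : ℕ} [NeZero d] (D : TopologicalSpace.Opens (E d))
    {s δ A B : ℝ} (hs : 0 < s) (hδ : 0 < δ) (hA : 0 ≤ A) (hB : 0 ≤ B) {η θ : L2D D}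
    (hη : MemHTilde D δ η) (hθ : MemHTilde D s θ) {e : E d → ℝ}
    (he : ∀ ξ, |e ξ| ≤ A * lapSymbol 1 ξ ^ ((δ + s) / 2) + B) :
    ‖∫ ξ, (e ξ : ℂ) * ((𝓕 (zeroExt D η) : L2 d) ξ *
      (starRingEnd ℂ) ((𝓕 (zeroExt D θ) : L2 d) ξ))‖ ≤
      A * (normHTilde D δ η * normHTilde D s θ) + B * (‖η‖ * ‖θ‖) := by
  set F : E d → ℂ := ⇑(𝓕 (zeroExt D η) : L2 d)
  set G : E d → ℂ := ⇑(𝓕 (zeroExt D θ) : L2 d)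
  have hF : Measurable F := (Lp.stronglyMeasurable (𝓕 (zeroExt D η) : L2 d)).measurable
  have hG : Measurable G := (Lp.stronglyMeasurable (𝓕 (zeroExt D θ) : L2 d)).measurable
  have hl := fun α => measurable_lapSymbol (d := d) α
  have hNη := normHTilde_nonneg D δ η
  have hNθ := normHTilde_nonneg D s θ
  have hsq : ∀ {r : ℝ}, 0 < r → ∀ (H : E d → ℂ) ξ,
      (ENNReal.ofReal (lapSymbol (r / 2) ξ) * ‖H ξ‖ₑ) ^ 2 =
        ENNReal.ofReal (lapSymbol r ξ) * ‖H ξ‖ₑ ^ 2 := by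
    intro r hr H ξ
    rw [mul_pow, ← ENNReal.ofReal_pow (lapSymbol_nonneg _ _), sq (lapSymbol _ _),
      lapSymbol_mul_self hr]
  have hL2 : ∀ ζ : L2D D, ∫⁻ ξ, ‖(𝓕 (zeroExt D ζ) : L2 d) ξ‖ₑ ^ 2 ≤ ENNReal.ofReal (‖ζ‖ ^ 2) := by
    intro ζ
    rw [lintegral_enorm_sq_eq, ← norm_zeroExt, ← Lp.norm_fourier_eq (zeroExt D ζ),
      ENNReal.ofReal_pow (norm_nonneg _), ofReal_norm]
  have h1 : ∫⁻ ξ, (ENNReal.ofReal (lapSymbol (δ / 2) ξ) * ‖F ξ‖ₑ) *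
      (ENNReal.ofReal (lapSymbol (s / 2) ξ) * ‖G ξ‖ₑ) ≤
      ENNReal.ofReal (normHTilde D δ η * normHTilde D s θ) := by
    refine lintegral_mul_le_of_sq_le (by fun_prop) (by fun_prop) hNη hNθ ?_ ?_
    · simp only [hsq hδ]; exact lintegral_lapSymbol_le_normHTilde D hδ hη
    · simp only [hsq hs]; exact lintegral_lapSymbol_le_normHTilde D hs hθ
  have h2 : ∫⁻ ξ, ‖F ξ‖ₑ * ‖G ξ‖ₑ ≤ ENNReal.ofReal (‖η‖ * ‖θ‖) :=
    lintegral_mul_le_of_sq_le (by fun_prop) (by fun_prop) (norm_nonneg _) (norm_nonneg _)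
      (hL2 η) (hL2 θ)
  have h3 : ‖∫ ξ, (e ξ : ℂ) * (F ξ * (starRingEnd ℂ) (G ξ))‖ₑ ≤
      ENNReal.ofReal (A * (normHTilde D δ η * normHTilde D s θ) + B * (‖η‖ * ‖θ‖)) := by
    calc _ ≤ ∫⁻ ξ, ‖(e ξ : ℂ) * (F ξ * (starRingEnd ℂ) (G ξ))‖ₑ := enorm_integral_le_lintegral_enorm _
      _ ≤ ∫⁻ ξ, (ENNReal.ofReal A * ((ENNReal.ofReal (lapSymbol (δ / 2) ξ) * ‖F ξ‖ₑ) *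
          (ENNReal.ofReal (lapSymbol (s / 2) ξ) * ‖G ξ‖ₑ)) +
          ENNReal.ofReal B * (‖F ξ‖ₑ * ‖G ξ‖ₑ)) := by
        refine lintegral_mono fun ξ => ?_
        have hle : ‖(e ξ : ℂ)‖ₑ ≤ ENNReal.ofReal A * (ENNReal.ofReal (lapSymbol (δ / 2) ξ) *
            ENNReal.ofReal (lapSymbol (s / 2) ξ)) + ENNReal.ofReal B := by
          rw [← ofReal_norm, Complex.norm_real, Real.norm_eq_abs,
            ← ENNReal.ofReal_mul (lapSymbol_nonneg _ _), ← ENNReal.ofReal_mul hA,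
            ← ENNReal.ofReal_add (by have := lapSymbol_nonneg (δ / 2) ξ
                                     have := lapSymbol_nonneg (s / 2) ξ; positivity) hB]
          refine ENNReal.ofReal_le_ofReal ((he ξ).trans (le_of_eq ?_))
          rw [lapSymbol_eq_rpow (δ / 2), lapSymbol_eq_rpow (s / 2),
            ← Real.rpow_add_of_nonneg (lapSymbol_nonneg _ _) (by positivity) (by positivity)]
          congr 3; ring
        simp only [enorm_mul, RCLike.enorm_conj]
        refine (mul_le_mul_left hle _).trans (le_of_eq ?_)
        ring
      _ = ENNReal.ofReal A * (∫⁻ ξ, (ENNReal.ofReal (lapSymbol (δ / 2) ξ) * ‖F ξ‖ₑ) *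
          (ENNReal.ofReal (lapSymbol (s / 2) ξ) * ‖G ξ‖ₑ)) +
          ENNReal.ofReal B * ∫⁻ ξ, (‖F ξ‖ₑ * ‖G ξ‖ₑ) := by
        rw [lintegral_add_right _ (by fun_prop), lintegral_const_mul' _ _ ENNReal.ofReal_ne_top,
          lintegral_const_mul' _ _ ENNReal.ofReal_ne_top]
      _ ≤ _ := by
        rw [ENNReal.ofReal_add (by positivity) (by positivity), ENNReal.ofReal_mul hA,
          ENNReal.ofReal_mul hB]
        gcongr
  rw [← ofReal_norm] at h3
  exact (ENNReal.ofReal_le_ofReal_iff (by positivity)).1 h3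

end SincQuad

theorem mainTheorem3 {d : ℕ} [NeZero d] (D : TopologicalSpace.Opens (SincQuad.E d))
    (s δ b k : ℝ) (hs : s ∈ Ioo (0 : ℝ) 1) (hδ : δ ∈ Ioc s (2 - s))
    (hb : b ∈ Ioo (0 : ℝ) Real.pi) (hk : 0 < k) (Nm Np : ℕ)
    (η θ : SincQuad.L2D D)
    (hη : SincQuad.MemHTilde D δ η) (hθ : SincQuad.MemHTilde D s θ) :
    ‖SincQuad.a D s η θ - SincQuad.ak D s k Nm Np η θ‖ ≤
      2 * SincQuad.cBand b / (δ - s) *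
          (2 / (Real.exp (2 * Real.pi * b / k) - 1) + Real.exp ((s - δ) * Np * k / 2)) *
          SincQuad.normHTilde D δ η * SincQuad.normHTilde D s θ +
        SincQuad.cBand b / s *
          (2 / (Real.exp (2 * Real.pi * b / k) - 1) + Real.exp (-s * Nm * k)) *
          ‖η‖ * ‖θ‖ := by
  have hs0 := hs.1
  have hδ0 : 0 < δ := hs0.trans hδ.1
  have hδs : 0 < δ - s := sub_pos.2 hδ.1
  have hc : 0 < SincQuad.cBand b := one_pos.trans_le (SincQuad.one_le_cBand hb)
  have hQ : 0 ≤ 2 / (Real.exp (2 * Real.pi * b / k) - 1) := by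
    have : 0 ≤ 2 * Real.pi * b / k := by have := hb.1; positivity
    exact div_nonneg two_pos.le (by linarith [Real.one_le_exp this])
  obtain ⟨hia, hae⟩ := SincQuad.a_eq_integral D hs0
    (SincQuad.mem_fracLapDomain_of_lintegral_lt_top hs0
      ((SincQuad.lintegral_lapSymbol_le_sobolevNormSq hs0.le hδ.1.le _).trans_lt hη))
    (SincQuad.mem_fracLapDomain_of_lintegral_lt_top hs0
      ((SincQuad.lintegral_lapSymbol_le_sobolevNormSq hs0.le le_rfl _).trans_lt hθ))
  obtain ⟨hik, hake⟩ := SincQuad.ak_eq_integral D s k Nm Np η θ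
  rw [hae, hake, ← integral_sub hia hik]
  simp only [← sub_mul, ← Complex.ofReal_sub]
  refine (SincQuad.norm_integral_symbol_le D hs0 hδ0
    (A := 2 * SincQuad.cBand b / (δ - s) *
      (2 / (Real.exp (2 * Real.pi * b / k) - 1) + Real.exp ((s - δ) * Np * k / 2)))
    (B := SincQuad.cBand b / s *
      (2 / (Real.exp (2 * Real.pi * b / k) - 1) + Real.exp (-s * Nm * k)))
    (by positivity) (by positivity) hη hθ fun ξ => ?_).trans (le_of_eq (by ring))
  -- The scalar estimate requires `l > 0`; at `l = 0` both symbols vanish.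
  rcases (SincQuad.lapSymbol_nonneg 1 ξ).eq_or_lt with h | h
  · rw [← h, Real.zero_rpow hs0.ne', Real.zero_rpow (by positivity)]
    simp only [zero_div, mul_zero, Finset.sum_const_zero, sub_zero, abs_zero, zero_add]
    positivity
  · exact SincQuad.abs_rpow_sub_sinc_le hs hδ hb hk Nm Np h
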